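/- **Theorem 2.1 (Adaptivity of Vitali trend filtering, simplified).** *Setting.* Let $N,d\ge 1$, $n=N^d$, and let $Y=f^0+\epsilon$ with $Y,f^0,\epsilon\in\mathbb R^{N\times\dots\times N}$ ($d$ indices in $\{1,\dots,N\}$), where $\epsilon$ has i.i.d. $\mathcal N(0,\sigma^2)$ entries, $\sigma>0$. Let $D^k=\prod_{i=1}^d D_i^k$ with $(D_i^kf)(j_1,\dots,j_d)=N^{k-1}\sum_{l=0}^k(-1)^l\binom kl f(j_1,\dots,j_i-l,\dots,j_d)$, so that $D^kf$ is indexed by $\{k+1,\dots,N\}^d$. Let $\mathcal N_k=\{f:D^kf=0\}$, and let $f_{\mathcal N_k^\perp}$ be the orthogonal projection of $f$ onto $\mathcal N_k^\perp$. The trend filtering estimator $\hat f$ is a minimizer over $\mathrm f\in\mathbb R^{N\times\dots\times N}$ of $\|(Y-\mathrm f)_{\mathcal N_k^\perp}\|_2^2/n+2\lambda\|D^k\mathrm f\|_1$. Put $\lambda_0(t)=\sigma\sqrt{(2\log(2n)+2t)/n}$. *Regular grids.* For $\rho\ge1$, a set $S\subseteq\{k+2,\dots,N-1\}^d$ of size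 $s=|S|\ge1$ is called a ($\rho$-)regular grid parallel to the coordinate axes if $S=T_1\times\dots\times T_d$ with $T_i=\{\tau_{i,1}<\dots<\tau_{i,r}\}$, $r=s^{1/d}$, where for each $i$, with $\tau_{i,0}=k+1$ and $\tau_{i,r+1}=N$, $$\frac{N}{\rho r}\le \tau_{i,m+1}-\tau_{i,m}\le\frac{\rho N}{r}\quad(0\le m\le r),\qquad \tau_{i,m+1}-\tau_{i,m}\ge k+1\quad(1\le m<r).$$ *Claim.* Let $k\in\{1,2,3,4\}$. There is a constant $C>0$ depending only on $k$, and, for every $\rho\ge 1$ and $d\ge1$, a constant $K>0$ depending only on $k,\rho,d$, such that for all $N$, $\sigma>0$, $f^0$, every tensor $g$, every $\rho$-regular grid $S$ with $s$ points, and every $$\lambda\ \ge\ C\,\rho^{\frac{2k-1}2}\,d^{3/2}\,\frac{\lambda_0(\log(2n))}{s^{\frac{2k-1}{2d}}},$$ the following holds. With probability at least $1-1/n$, a minimizer $\hat f$ exists and every minimizer satisfies $$\frac{\|(\hat f-f^0)_{\mathcal N_k^\perp}\|_2^2}{n}\ \le\ \frac{\|g-f^0_{\mathcal N_k^\perp}\|_2^2}{n}+4\lambda\sum_{j\notin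 S}|(D^kg)_j|+K\,\lambda^2\,s^{2k}\log(n/s).$$ Consequently, if moreover $\lambda\le B\,\lambda_0(\log(2n))/s^{\frac{2k-1}{2d}}$ and $(D^kf^0)_j=0$ for all $j\notin S$, then with probability at least $1-1/n$ a minimizer exists and every minimizer satisfies $$\frac{\|(\hat f-f^0)_{\mathcal N_k^\perp}\|_2^2}{n}\ \le\ K\,B^2\sigma^2\,\frac{s^{2k-\frac{2k-1}{d}}\,\log n\,\log(n/s)}{n}.$$ -/

import Mathlib

open MeasureTheory ProbabilityTheory

noncomputable section

namespace VitaliTF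

/-- Real tensors with `d` indices, each running over `{1, …, N}`, with the Frobenius norm and its
inner product. The number of entries is `n = N ^ d`. -/
abbrev Tensor (d N : ℕ) : Type :=
  EuclideanSpace ℝ (Fin d → Finset.Icc 1 N)

/-- The multi-indices `{k + 1, …, N} ^ d` of the total `k`-th order differences of a tensor. -/
abbrev DiffIndex (d k N : ℕ) : Type :=
  Fin d → Finset.Icc (k + 1) N

/-- A tensor read as a function on all of `ℕ ^ d` (zero outside `{1, …, N} ^ d`). This only serves
to compose the difference operators; the values outside are never used by `vitaliDiff`. -/
def zeroExt (d N : ℕ) : Tensor d N →ₗ[ℝ] ((Fin d → ℕ) → ℝ) where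
  toFun f j := if h : ∀ i, j i ∈ Finset.Icc 1 N then f (fun i => ⟨j i, h i⟩) else 0
  map_add' f g := by
    funext j
    by_cases h : ∀ i, j i ∈ Finset.Icc 1 N
    · simp only [Pi.add_apply, dif_pos h, PiLp.add_apply]
    · simp only [Pi.add_apply, dif_neg h, add_zero]
  map_smul' c f := by
    funext j
    by_cases h : ∀ i, j i ∈ Finset.Icc 1 N
    · simp only [Pi.smul_apply, dif_pos h, PiLp.smul_apply, RingHom.id_apply]
    · simp only [Pi.smul_apply, dif_neg h, smul_zero]

/-- The `k`-th order difference along coordinate `i`, with the factor `N ^ (k - 1)` that comes from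
the discretization:
`(Dᵢᵏ f)(j) = N ^ (k - 1) * ∑ l = 0, …, k, (-1) ^ l * (k choose l) * f (j₁, …, jᵢ - l, …, j_d)`. -/
def partialDiff {d : ℕ} (k N : ℕ) (i : Fin d) : Module.End ℝ ((Fin d → ℕ) → ℝ) where
  toFun f j := (N : ℝ) ^ (k - 1) * ∑ l ∈ Finset.range (k + 1),
    (-1 : ℝ) ^ l * (k.choose l : ℝ) * f (Function.update j i (j i - l))
  map_add' f g := by
    funext j
    simp only [Pi.add_apply, mul_add, Finset.sum_add_distrib]
  map_smul' c f := by
    funext j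
    simp only [Pi.smul_apply, smul_eq_mul, RingHom.id_apply, Finset.mul_sum]
    exact Finset.sum_congr rfl fun l _ => by ring

/-- The total `k`-th order difference operator `Dᵏ = ∏ i, Dᵢᵏ`, evaluated on
`{k + 1, …, N} ^ d`. -/
def vitaliDiff {d N : ℕ} (k : ℕ) : Tensor d N →ₗ[ℝ] (DiffIndex d k N → ℝ) :=
  (LinearMap.funLeft ℝ ℝ fun (j : DiffIndex d k N) (i : Fin d) => (j i : ℕ)) ∘ₗ
    ((List.finRange d).map fun i => partialDiff (d := d) k N i).prod ∘ₗ zeroExt d N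

/-- The `k`-th order Vitali total variation `‖Dᵏ f‖₁`. -/
def vitaliTV {d N : ℕ} (k : ℕ) (f : Tensor d N) : ℝ :=
  ∑ j, |vitaliDiff k f j|

/-- The `d`-dimensional margin of `f`: its orthogonal projection onto the orthogonal complement of
the nullspace of `Dᵏ`. -/
def margin {d N : ℕ} (k : ℕ) (f : Tensor d N) : Tensor d N :=
  (LinearMap.ker (vitaliDiff (d := d) (N := N) k))ᗮ.starProjection f

/-- `f` is a `k`-th order Vitali trend filtering estimate for the data `y` with tuning parameter
`lam`: it minimizes `‖margin (y - f)‖² / n + 2 * lam * TV_k(f)` over all tensors. (The minimizer is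
unique only up to the nullspace of `Dᵏ`, that is, its margin is unique.) -/
def IsTrendFilter {d N : ℕ} (k : ℕ) (lam : ℝ) (y f : Tensor d N) : Prop :=
  IsMinOn (fun u : Tensor d N =>
    ‖margin k (y - u)‖ ^ 2 / (N : ℝ) ^ d + 2 * lam * vitaliTV k u) Set.univ f

/-- The universal choice `σ √((2 log (2 n) + 2 t) / n)` of the tuning parameter. -/
def lambda0 (σ n t : ℝ) : ℝ :=
  σ * √((2 * Real.log (2 * n) + 2 * t) / n)

/-- `S` is a regular grid of `r × ⋯ × r` points (`r ≥ 1`) parallel to the coordinate axes. The grid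
points have coordinates `k + 1 < τ i 1 < ⋯ < τ i r < N` along coordinate `i`. All spacings, those
to the two ends `k + 1 = τ i 0` and `N = τ i (r + 1)` included, agree with `N / r` up to the
factor `ρ`, and the blocks `{τ i m, …, τ i m + k - 1}` have a further index between them. -/
def IsRegularGrid {d k N : ℕ} (ρ : ℝ) (S : Finset (DiffIndex d k N)) : Prop :=
  ∃ (r : ℕ) (τ : Fin d → ℕ → ℕ), 1 ≤ r ∧
    (∀ i, τ i 0 = k + 1 ∧ τ i (r + 1) = N) ∧
    (∀ i, ∀ m ≤ r, τ i m < τ i (m + 1) ∧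
      (N : ℝ) / (ρ * r) ≤ (τ i (m + 1) : ℝ) - (τ i m : ℝ) ∧
      (τ i (m + 1) : ℝ) - (τ i m : ℝ) ≤ ρ * N / r) ∧
    (∀ i m, 1 ≤ m → m < r → τ i m + k + 1 ≤ τ i (m + 1)) ∧
    ∀ j : DiffIndex d k N, j ∈ S ↔ ∀ i, ∃ m, 1 ≤ m ∧ m ≤ r ∧ (j i : ℕ) = τ i m

end VitaliTF

end

/-! The estimator is an analysis version of the lasso: the penalty is the `ℓ¹` norm of `D u`, and
the fit sees `u` only modulo `ker D`. Strong convexity at a minimizer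
(`analysisObjective_add_sq_le`) reduces the oracle inequality (`analysis_oracle`) to two facts about
the error `u = f - g`. The noise `⟪ε, M u⟫`, with `M` the projection onto the orthogonal complement
of `ker D`, should be at most `n λ ∑ v j |D u j|` over `j ∉ S` plus `A ‖M u‖`. Any sign pattern on
`S` should extend to `w` with `|w| ≤ 1 - v` off `S` and `∑ w j D u j ≤ Γ ‖u‖`. If the same weights
`v` serve in both, the off-grid noise is paid by the slack of `w`, and completing the square leaves
`n (λ Γ + A / n) ^ 2`.

Noise. Modulo `ker D`, every tensor is a combination of atoms: products of polynomials of degree `k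
- 1`, each truncated at one coordinate of `j`. Moving the cuts to grid coordinates gives a tensor
whose total difference lives on blocks of `k` consecutive indices per coordinate.
`noise_decomposition` projects such tensors out. The rest of an atom is small (`norm_proj_atom_le`):
the two truncations differ only between the cuts, where the polynomial is small, and this yields the
power `(2 k - 1) / 2` of the distance to the grid. The projected part has dimension at most `k ^ d
s` modulo the kernel, whence `A`. A union bound over at most `2 n` Gaussian functionals controls
everything.

Interpolation. Around each grid point sits a spike, the average over the coordinates of a product
with a critical profile `α` in that coordinate and smooth cutoffs `φ` in the others
(`exists_profile`). It equals 1 at the grid point and drops at least as fast as the noise weight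
(`exists_interpolation`). `Γ` bounds the norm of the adjoint difference of `w`, a product of
one-dimensional energies (`GridLine.sum_sq_bumpDiff_le`). With bumps of width of order `N / r` each
energy is of order `r ^ (2 k) / N`, so the product times `n` is of order `s ^ (2 k)`. For `k ≤ 2`
the profile behaves like `1 - |y| ^ (k - 1 / 2)`, whose `k`-th derivative misses square
integrability by a logarithm. This is the source of `log (n / s)`, and it enters once because each
product contains a single `α`. -/

namespace VitaliTF

set_option linter.unusedSectionVars false

/-! ### Analysis estimators: existence, oracle inequality, splitting of the noise -/

section Abstract

open scoped RealInnerProductSpace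

variable {E ι : Type*} [NormedAddCommGroup E] [InnerProductSpace ℝ E] [FiniteDimensional ℝ E]
  [Fintype ι] (D : E →ₗ[ℝ] ι → ℝ)

/-- The analysis operator only sees the component orthogonal to its kernel. -/
theorem map_kerPerp (u : E) : D ((LinearMap.ker D)ᗮ.starProjection u) = D u := by
  have h : u - (LinearMap.ker D)ᗮ.starProjection u ∈ LinearMap.ker D := by
    have := Submodule.sub_starProjection_mem_orthogonal (K := (LinearMap.ker D)ᗮ) u
    rwa [Submodule.orthogonal_orthogonal] at this
  have h2 : D (u - (LinearMap.ker D)ᗮ.starProjection u) = 0 := h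
  rw [map_sub, sub_eq_zero] at h2
  exact h2.symm

/-- The penalized least squares objective of the analysis estimator. -/
noncomputable def analysisObjective (n lam : ℝ) (y u : E) : ℝ :=
  ‖(LinearMap.ker D)ᗮ.starProjection (y - u)‖ ^ 2 / n + 2 * lam * ∑ j, |D u j|

theorem continuous_analysisObjective (n lam : ℝ) (y : E) :
    Continuous (analysisObjective D n lam y) := by
  have hD : Continuous D := D.continuous_of_finiteDimensional
  unfold analysisObjective
  fun_prop

/-- The objective is constant along `ker D`, hence not coercive. Replacing `u` by its component
orthogonal to the kernel restores compactness. -/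
theorem exists_isMinOn_analysisObjective {n lam : ℝ} (hn : 0 < n) (hlam : 0 ≤ lam) (y : E) :
    ∃ f, IsMinOn (analysisObjective D n lam y) Set.univ f := by
  set M := (LinearMap.ker D)ᗮ.starProjection with hM
  have hcomp : IsCompact (Metric.closedBall (0 : E) (2 * ‖y‖)) := isCompact_closedBall _ _
  obtain ⟨f, -, hf⟩ := hcomp.exists_isMinOn ⟨0, by simp⟩
    (continuous_analysisObjective D n lam y).continuousOn
  refine ⟨f, fun u _ => ?_⟩
  have hMM : ∀ v, M (M v) = M v := fun v =>
    Submodule.starProjection_eq_self_iff.2 (Submodule.starProjection_apply_mem _ _)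
  have hu : analysisObjective D n lam y u = analysisObjective D n lam y (M u) := by
    unfold analysisObjective
    rw [← hM, map_sub M y u, map_sub M y (M u), hMM, hM, map_kerPerp]
  simp only [Set.mem_ofPred_eq, hu]
  by_cases h : M u ∈ Metric.closedBall (0 : E) (2 * ‖y‖)
  · exact hf h
  -- Outside the ball of radius `2 ‖y‖` the fit term alone already exceeds the objective at `0`.
  · have h0 : analysisObjective D n lam y f ≤ analysisObjective D n lam y 0 :=
      hf (by simp)
    refine h0.trans ?_
    simp only [Metric.mem_closedBall, dist_zero_right, not_le] at h
    have hy : ‖M y‖ ≤ ‖y‖ := Submodule.norm_starProjection_apply_le _ _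
    have h1 : ‖M y‖ ≤ ‖M y - M u‖ := by
      have := norm_sub_norm_le (M u) (M y)
      rw [norm_sub_rev] at this
      linarith
    simp only [analysisObjective, ← hM, map_sub, map_zero, sub_zero, Pi.zero_apply, abs_zero,
      Finset.sum_const_zero, mul_zero, add_zero, hMM]
    have h2 : ‖M y‖ ^ 2 / n ≤ ‖M y - M u‖ ^ 2 / n := by gcongr
    have h3 : 0 ≤ 2 * lam * ∑ j, |D (M u) j| :=
      mul_nonneg (by linarith) (Finset.sum_nonneg fun _ _ => abs_nonneg _)
    linarith

/-- Strong convexity of the objective at a minimizer. -/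
theorem analysisObjective_add_sq_le {n lam : ℝ} (hlam : 0 ≤ lam) {y f : E}
    (hf : IsMinOn (analysisObjective D n lam y) Set.univ f) (g : E) :
    analysisObjective D n lam y f + ‖(LinearMap.ker D)ᗮ.starProjection (f - g)‖ ^ 2 / n ≤
      analysisObjective D n lam y g := by
  set M := (LinearMap.ker D)ᗮ.starProjection with hM
  set a := M (y - f) with ha
  set b := M (g - f) with hb
  set Y := ‖b‖ ^ 2 / n with hY
  set X := -2 * ⟪a, b⟫ / n + 2 * lam * (∑ j, |D g j| - ∑ j, |D f j|) with hX
  -- Minimality against the point at fraction `t` of the segment from `f` to `g`, divided by `t`.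
  -- Letting `t → 0` leaves `0 ≤ X`, and the objective at `g` exceeds the one at `f` by exactly `X +
  -- Y` .
  have key : ∀ t : ℝ, 0 < t → t ≤ 1 → 0 ≤ X + t * Y := by
    intro t ht ht1
    have h1 : analysisObjective D n lam y f ≤ analysisObjective D n lam y (f + t • (g - f)) :=
      hf (Set.mem_univ _)
    have h2 : M (y - (f + t • (g - f))) = a - t • b := by
      rw [ha, hb, ← map_smul, ← map_sub]; congr 1; abel
    have h3 : ∑ j, |D (f + t • (g - f)) j| ≤ (1 - t) * ∑ j, |D f j| + t * ∑ j, |D g j| := by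
      rw [Finset.mul_sum, Finset.mul_sum, ← Finset.sum_add_distrib]
      refine Finset.sum_le_sum fun j _ => ?_
      have : D (f + t • (g - f)) j = (1 - t) * D f j + t * D g j := by
        simp only [map_add, map_smul, map_sub, Pi.add_apply, Pi.smul_apply, Pi.sub_apply,
          smul_eq_mul]
        ring
      rw [this]
      refine (abs_add_le _ _).trans ?_
      rw [abs_mul, abs_mul, abs_of_nonneg (by linarith : 0 ≤ 1 - t), abs_of_pos ht]
    have h4 : 2 * lam * ∑ j, |D (f + t • (g - f)) j| ≤
        2 * lam * ((1 - t) * ∑ j, |D f j| + t * ∑ j, |D g j|) :=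
      mul_le_mul_of_nonneg_left h3 (by linarith)
    have h5 : ‖a - t • b‖ ^ 2 = ‖a‖ ^ 2 - 2 * t * ⟪a, b⟫ + t ^ 2 * ‖b‖ ^ 2 := by
      rw [norm_sub_sq_real, inner_smul_right, norm_smul, mul_pow, Real.norm_eq_abs, sq_abs]; ring
    simp only [analysisObjective, ← hM, h2, h5, ← ha] at h1
    have h6 : 0 ≤ t * (X + t * Y) := by
      have e : t * (X + t * Y) = (‖a‖ ^ 2 - 2 * t * ⟪a, b⟫ + t ^ 2 * ‖b‖ ^ 2) / n - ‖a‖ ^ 2 / n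
          + (2 * lam * ((1 - t) * ∑ j, |D f j| + t * ∑ j, |D g j|) - 2 * lam * ∑ j, |D f j|) := by
        rw [hX, hY]; ring
      rw [e]; linarith
    exact nonneg_of_mul_nonneg_right h6 ht
  have hX0 : 0 ≤ X := by
    have hlim : Filter.Tendsto (fun t : ℝ => X + t * Y) (nhdsWithin 0 (Set.Ioi 0)) (nhds X) := by
      have : Filter.Tendsto (fun t : ℝ => X + t * Y) (nhds 0) (nhds (X + 0 * Y)) := by
        apply Continuous.tendsto; fun_prop
      rw [zero_mul, add_zero] at this
      exact this.mono_left nhdsWithin_le_nhds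
    refine ge_of_tendsto hlim ?_
    filter_upwards [Ioc_mem_nhdsGT (zero_lt_one' ℝ)] with t ht
    exact key t ht.1 ht.2
  have h7 : M (y - g) = a - b := by rw [ha, hb, ← map_sub]; congr 1; abel
  have h8 : ‖M (f - g)‖ = ‖b‖ := by rw [hb, ← norm_neg, ← map_neg, neg_sub]
  simp only [analysisObjective, ← hM, h7, h8, norm_sub_sq_real, ← ha]
  have : (‖a‖ ^ 2 - 2 * ⟪a, b⟫ + ‖b‖ ^ 2) / n = ‖a‖ ^ 2 / n + -2 * ⟪a, b⟫ / n + ‖b‖ ^ 2 / n := by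
    ring
  rw [this]
  nlinarith [hX0]

theorem abs_sub_abs_add_le_sign (a b : ℝ) : |a| - |a + b| ≤ -(SignType.sign a : ℝ) * b := by
  rcases lt_trichotomy a 0 with h | h | h
  · simp [sign_neg h, abs_of_neg h]; linarith [neg_abs_le (a + b)]
  · simp [h]
  · simp [sign_pos h, abs_of_pos h]; linarith [le_abs_self (a + b)]

/-- Deterministic oracle inequality for the analysis estimator. -/
theorem analysis_oracle [DecidableEq ι] {n lam A Gam : ℝ} (hn : 0 < n) (hlam : 0 ≤ lam)
    {f0 eps f g : E} {S : Finset ι} {v : ι → ℝ}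
    (hf : IsMinOn (analysisObjective D n lam (f0 + eps)) Set.univ f)
    (hnoise : ∀ u, ⟪eps, (LinearMap.ker D)ᗮ.starProjection u⟫ ≤
      n * lam * ∑ j ∈ Sᶜ, v j * |D u j| + A * ‖(LinearMap.ker D)ᗮ.starProjection u‖)
    (hinter : ∀ q : ι → ℝ, (∀ j, |q j| ≤ 1) → ∃ w : ι → ℝ, (∀ j ∈ S, w j = q j) ∧
      (∀ j ∉ S, |w j| ≤ 1 - v j) ∧ ∀ u, ∑ j, w j * D u j ≤ Gam * ‖u‖) :
    ‖(LinearMap.ker D)ᗮ.starProjection (f - f0)‖ ^ 2 / n ≤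
      ‖g - (LinearMap.ker D)ᗮ.starProjection f0‖ ^ 2 / n + 4 * lam * ∑ j ∈ Sᶜ, |D g j|
        + n * (lam * Gam + A / n) ^ 2 := by
  set M := (LinearMap.ker D)ᗮ.starProjection with hM
  have h1 := analysisObjective_add_sq_le D hlam hf g
  set u := f - g with hu
  have hfu : D f = D g + D u := by rw [hu, map_sub]; abel
  -- On `S`, `w` is minus a subgradient of the penalty at `g`, so `w j * D u j` bounds the decrease
  -- of the penalty from `g` to `f`.
  obtain ⟨w, hwS, hwSc, hw⟩ := hinter (fun j => -(SignType.sign (D g j) : ℝ)) (fun j => by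
    rcases lt_trichotomy (D g j) 0 with h | h | h
    · simp [sign_neg h]
    · simp [h]
    · simp [sign_pos h])
  have hTV : ∑ j, |D g j| - ∑ j, |D f j| + ∑ j ∈ Sᶜ, v j * |D u j| ≤
      2 * ∑ j ∈ Sᶜ, |D g j| + ∑ j, w j * D u j := by
    rw [← Finset.sum_sub_distrib, ← Finset.sum_add_sum_compl S (fun j => |D g j| - |D f j|),
      ← Finset.sum_add_sum_compl S (fun j => w j * D u j), Finset.mul_sum]
    have e1 : ∑ j ∈ S, (|D g j| - |D f j|) ≤ ∑ j ∈ S, w j * D u j := by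
      refine Finset.sum_le_sum fun j hj => ?_
      rw [hwS j hj, hfu]
      exact abs_sub_abs_add_le_sign _ _
    have e2 : ∑ j ∈ Sᶜ, (|D g j| - |D f j|) + ∑ j ∈ Sᶜ, v j * |D u j| ≤
        ∑ j ∈ Sᶜ, 2 * |D g j| + ∑ j ∈ Sᶜ, w j * D u j := by
      rw [← Finset.sum_add_distrib, ← Finset.sum_add_distrib]
      refine Finset.sum_le_sum fun j hj => ?_
      have hj' : j ∉ S := Finset.mem_compl.1 hj
      have a1 : |D u j| ≤ |D f j| + |D g j| := by
        have : D u j = D f j - D g j := by rw [hfu]; simp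
        rw [this]; exact abs_sub _ _
      have a2 : -(w j * D u j) ≤ (1 - v j) * |D u j| := by
        refine (neg_le_abs _).trans ?_
        rw [abs_mul]
        exact mul_le_mul_of_nonneg_right (hwSc j hj') (abs_nonneg _)
      nlinarith
    linarith
  have hMu : M u = M (f - f0) - M (g - f0) := by rw [← map_sub]; congr 1; rw [hu]; abel
  have hyf : M (f0 + eps - f) = M eps - M (f - f0) := by rw [← map_sub]; congr 1; abel
  have hyg : M (f0 + eps - g) = M eps - M (g - f0) := by rw [← map_sub]; congr 1; abel
  have hMM : ∀ v, M (M v) = M v := fun v =>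
    Submodule.starProjection_eq_self_iff.2 (Submodule.starProjection_apply_mem _ _)
  have hin : ⟪M eps, M u⟫ = ⟪eps, M u⟫ := by
    rw [hM, Submodule.inner_starProjection_left_eq_right, ← hM, hMM]
  have hno := hnoise u
  have hw1 := hw (M u)
  rw [hM, map_kerPerp, ← hM] at hw1
  have hgM : ‖M (g - f0)‖ ≤ ‖g - M f0‖ := by
    have : M (g - f0) = M (g - M f0) := by rw [map_sub, map_sub, hMM]
    rw [this]; exact Submodule.norm_starProjection_apply_le _ _
  have hgM2 : ‖M (g - f0)‖ ^ 2 / n ≤ ‖g - M f0‖ ^ 2 / n := by gcongr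
  simp only [analysisObjective, ← hM, hyf, hyg, norm_sub_sq_real] at h1
  have hdiff : ⟪M eps, M (f - f0)⟫ - ⟪M eps, M (g - f0)⟫ = ⟪eps, M u⟫ := by
    rw [← inner_sub_right, ← hMu, hin]
  set X := ‖M u‖
  set G := ∑ j, w j * D u j
  set V := ∑ j ∈ Sᶜ, v j * |D u j|
  have h2 : ‖M (f - f0)‖ ^ 2 / n + X ^ 2 / n ≤ ‖M (g - f0)‖ ^ 2 / n + 2 * ⟪eps, M u⟫ / n
      + 2 * lam * (∑ j, |D g j| - ∑ j, |D f j|) := by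
    rw [← hdiff]
    have e1 : ∀ p q r : ℝ, (p - 2 * q + r) / n = p / n - 2 * q / n + r / n := by intros; ring
    rw [e1, e1] at h1
    have e2 : ∀ p q : ℝ, 2 * (p - q) / n = 2 * p / n - 2 * q / n := by intros; ring
    rw [e2]
    linarith
  have h3 : 2 * ⟪eps, M u⟫ / n ≤ 2 * lam * V + 2 * A * X / n := by
    have : 2 * lam * V + 2 * A * X / n = 2 * (n * lam * V + A * X) / n := by field_simp
    rw [this]
    gcongr
  have h4 : 2 * lam * (∑ j, |D g j| - ∑ j, |D f j| + V) ≤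
      2 * lam * (2 * ∑ j ∈ Sᶜ, |D g j| + Gam * X) :=
    mul_le_mul_of_nonneg_left (by linarith) (by linarith)
  -- The terms linear in `X = ‖M u‖` are absorbed by the quadratic gain from strong convexity.
  have h5 : 2 * A * X / n + 2 * lam * (Gam * X) ≤ X ^ 2 / n + n * (lam * Gam + A / n) ^ 2 := by
    have e : X ^ 2 / n + n * (lam * Gam + A / n) ^ 2 - (2 * A * X / n + 2 * lam * (Gam * X)) =
        (X - n * (lam * Gam + A / n)) ^ 2 / n := by field_simp; ring
    have : 0 ≤ (X - n * (lam * Gam + A / n)) ^ 2 / n := by positivity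
    linarith
  nlinarith

/-- Elements whose analysis coefficients vanish off `T`. -/
def coeffSupported (T : Finset ι) : Submodule ℝ E where
  carrier := {f | ∀ j ∉ T, D f j = 0}
  add_mem' {f g} hf hg j hj := by simp [hf j hj, hg j hj]
  zero_mem' j _ := by simp
  smul_mem' c f hf j hj := by simp [hf j hj]

/-- The component of `coeffSupported D T` orthogonal to the kernel. -/
noncomputable def coeffSpan (T : Finset ι) : Submodule ℝ E := coeffSupported D T ⊓ (LinearMap.ker D)ᗮ

/-- An element orthogonal to `ker D` is determined by its coefficients, and only those in `T` can be
nonzero. -/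
theorem finrank_coeffSpan_le (T : Finset ι) : Module.finrank ℝ (coeffSpan D T) ≤ T.card := by
  let R : coeffSpan D T →ₗ[ℝ] (T → ℝ) :=
    (LinearMap.funLeft ℝ ℝ (fun j : T => (j : ι))) ∘ₗ D ∘ₗ (coeffSpan D T).subtype
  have hR : Function.Injective R := by
    rw [← LinearMap.ker_eq_bot, LinearMap.ker_eq_bot']
    intro f hf
    have h0 : D f = 0 := by
      funext j
      by_cases hj : j ∈ T
      · exact congrFun hf ⟨j, hj⟩
      · exact f.2.1 j hj
    have h1 : (f : E) ∈ LinearMap.ker D := h0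
    have h2 := (Submodule.mem_orthogonal _ _).1 f.2.2 f h1
    exact Subtype.ext (inner_self_eq_zero.1 h2)
  have := LinearMap.finrank_le_finrank_of_injective hR
  simpa using this

/-- With `W = coeffSupported D T`, the part of `u` orthogonal to `W` involves only the `psi j` with
`j ∉ T`, since `ker D` and the other `psi j` lie in `W`. The remaining part of the margin lies in
the low-dimensional `coeffSpan D T`, where Cauchy–Schwarz suffices. Projecting the `psi j` before
testing them against the noise is what makes their coefficients small. -/
theorem noise_decomposition [DecidableEq ι] (T : Finset ι) (psi : ι → E)
    (hpsi : ∀ j, D (psi j) = Pi.single j 1) (eps u : E) :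
    ⟪eps, (LinearMap.ker D)ᗮ.starProjection u⟫ ≤
      ∑ j ∈ Tᶜ, |⟪eps, (coeffSupported D T)ᗮ.starProjection (psi j)⟫| * |D u j| +
        ‖(coeffSpan D T).starProjection eps‖ * ‖(LinearMap.ker D)ᗮ.starProjection u‖ := by
  set M := (LinearMap.ker D)ᗮ.starProjection with hM
  set W := coeffSupported D T with hW
  set V := coeffSpan D T with hV
  have hkW : LinearMap.ker D ≤ W := fun f hf j _ => by
    rw [LinearMap.mem_ker.1 hf]; rfl
  have hWk : Wᗮ ≤ (LinearMap.ker D)ᗮ := Submodule.orthogonal_le hkW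
  have hWV : M u - Wᗮ.starProjection u ∈ V := by
    refine ⟨?_, ?_⟩
    · have h1 : u - Wᗮ.starProjection u ∈ W := by
        have := Submodule.sub_starProjection_mem_orthogonal (K := Wᗮ) u
        rwa [Submodule.orthogonal_orthogonal] at this
      have h2 : u - M u ∈ W := by
        have := Submodule.sub_starProjection_mem_orthogonal (K := (LinearMap.ker D)ᗮ) u
        rw [Submodule.orthogonal_orthogonal] at this
        exact hkW this
      have h3 := W.sub_mem h1 h2
      rwa [sub_sub_sub_cancel_left] at h3
    · exact Submodule.sub_mem _ (Submodule.starProjection_apply_mem _ _)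
        (hWk (Submodule.starProjection_apply_mem _ _))
  have hVu : M u - Wᗮ.starProjection u = V.starProjection (M u) := by
    refine (Submodule.eq_starProjection_of_mem_orthogonal hWV ?_).symm
    rw [sub_sub_cancel]
    have : V ≤ W := inf_le_left
    exact Submodule.orthogonal_le this (Submodule.starProjection_apply_mem _ _)
  have hsplit : ⟪eps, M u⟫ = ⟪eps, Wᗮ.starProjection u⟫ + ⟪V.starProjection eps, M u⟫ := by
    rw [Submodule.inner_starProjection_left_eq_right, ← hVu, ← inner_add_right]
    congr 1; abel
  -- The `psi j` form a right inverse of `D`, so they synthesize `u` from its coefficients up to the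
  -- kernel.
  have hker : u - ∑ j, D u j • psi j ∈ LinearMap.ker D := by
    rw [LinearMap.mem_ker, map_sub, map_sum, sub_eq_zero]
    funext i
    simp [hpsi, Pi.single_apply]
  have hmemW : ∀ f ∈ W, Wᗮ.starProjection f = 0 := fun f hf =>
    (Submodule.starProjection_apply_eq_zero_iff _).2 (by rwa [Submodule.orthogonal_orthogonal])
  have hWu : Wᗮ.starProjection u = ∑ j ∈ Tᶜ, D u j • Wᗮ.starProjection (psi j) := by
    have h1 := hmemW _ (hkW hker)
    rw [map_sub, sub_eq_zero, map_sum, ← Finset.sum_add_sum_compl T] at h1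
    rw [h1, Finset.sum_eq_zero, zero_add]
    · simp
    · intro j hj
      rw [map_smul, hmemW, smul_zero]
      intro i hi
      rw [hpsi, Pi.single_apply, if_neg]
      rintro rfl; exact hi hj
  rw [hsplit, hWu, inner_sum]
  refine add_le_add (Finset.sum_le_sum fun j _ => ?_) (real_inner_le_norm _ _)
  rw [inner_smul_right, mul_comm, ← abs_mul]
  exact le_abs_self _

/-- The projection onto a subspace is controlled by the coordinates in an orthonormal basis. -/
theorem norm_starProjection_le_of_basis (V : Submodule ℝ E) {x : E} {c : ℝ} (hc : 0 ≤ c)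
    (h : ∀ i, |⟪x, (stdOrthonormalBasis ℝ V i : E)⟫| ≤ c) :
    ‖V.starProjection x‖ ≤ √(Module.finrank ℝ V) * c := by
  have h1 : ‖V.starProjection x‖ ^ 2 ≤ Module.finrank ℝ V * c ^ 2 := by
    have e : ‖V.starProjection x‖ ^ 2 = ∑ i, ⟪x, (stdOrthonormalBasis ℝ V i : E)⟫ ^ 2 := by
      set p : V := ⟨V.starProjection x, Submodule.starProjection_apply_mem _ _⟩ with hp
      have : ‖V.starProjection x‖ = ‖p‖ := rfl
      rw [this, ← (stdOrthonormalBasis ℝ V).sum_sq_norm_inner_left p]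
      refine Finset.sum_congr rfl fun i _ => ?_
      rw [Real.norm_eq_abs, sq_abs, Submodule.coe_inner, hp,
        Submodule.inner_starProjection_left_eq_right,
        Submodule.starProjection_eq_self_iff.2 (stdOrthonormalBasis ℝ V i).2]
    rw [e]
    calc _ ≤ ∑ _i : Fin (Module.finrank ℝ V), c ^ 2 :=
          Finset.sum_le_sum fun i _ => sq_le_sq' (abs_le.1 (h i)).1 (abs_le.1 (h i)).2
      _ = _ := by simp
  refine le_of_sq_le_sq ?_ (by positivity)
  rw [mul_pow, Real.sq_sqrt (by positivity)]
  exact h1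

end Abstract

/-! ### Gaussian tails and the union bound -/

section Tail

open scoped RealInnerProductSpace

variable {κ Ω : Type*} [Fintype κ] [MeasurableSpace Ω] {P : Measure Ω} [IsProbabilityMeasure P]

theorem hasSubgaussianMGF_of_gaussian {X : Ω → ℝ} {v : NNReal}
    (h : HasLaw X (gaussianReal 0 v) P) : HasSubgaussianMGF X v P where
  integrable_exp_mul t := by
    have h1 : Integrable (fun x => Real.exp (t * x)) (P.map X) := by
      rw [h.map_eq]; exact integrable_exp_mul_gaussianReal t
    exact h1.comp_aemeasurable h.aemeasurable
  mgf_le t := by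
    rw [mgf_gaussianReal h.map_eq]
    simp

/-- The inner product is a sum of independent sub-Gaussian variables with total variance proxy `σ ^
2 * ‖a‖ ^ 2`; the factor 2 accounts for both tails. The strict inequality makes the event empty for
`a = 0`. -/
theorem gaussian_inner_tail {σ : NNReal} (hσ : 0 < σ) {eps : Ω → EuclideanSpace ℝ κ}
    (hlaw : ∀ j, HasLaw (fun ω => eps ω j) (gaussianReal 0 (σ ^ 2)) P)
    (hind : iIndepFun (fun j ω => eps ω j) P) (a : EuclideanSpace ℝ κ) {x : ℝ} (hx : 0 ≤ x) :
    P.real {ω | σ * x * ‖a‖ < |⟪eps ω, a⟫|} ≤ 2 * Real.exp (-x ^ 2 / 2) := by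
  by_cases ha : a = 0
  · simp only [ha, norm_zero, mul_zero, inner_zero_right, abs_zero, lt_irrefl]
    simp only [Set.ofPred_false, measureReal_empty]
    positivity
  have hna : 0 < ‖a‖ := norm_pos_iff.2 ha
  have hsub : HasSubgaussianMGF (fun ω => ⟪eps ω, a⟫)
      (∑ j, ‖a j‖₊ ^ 2 * σ ^ 2) P := by
    have h1 := HasSubgaussianMGF.sum_of_iIndepFun (s := Finset.univ)
      (X := fun j ω => a j * eps ω j) (c := fun j => ‖a j‖₊ ^ 2 * σ ^ 2)
      (hind.comp (fun j y => a j * y) (fun j => measurable_const_mul (a j)))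
      (fun j _ => by
        have h := (hasSubgaussianMGF_of_gaussian (hlaw j)).const_mul (a j)
        refine ⟨h.1, fun t => (h.2 t).trans_eq ?_⟩
        congr 3
        simp only [NNReal.coe_mul, NNReal.coe_pow, coe_nnnorm, Real.norm_eq_abs, sq_abs]
        rfl)
    refine h1.congr (Filter.Eventually.of_forall fun ω => ?_)
    simp [PiLp.inner_apply]
  have hc : ((∑ j, ‖a j‖₊ ^ 2 * σ ^ 2 : NNReal) : ℝ) =
      ‖a‖ ^ 2 * (σ : ℝ) ^ 2 := by
    rw [EuclideanSpace.norm_sq_eq, Finset.sum_mul, NNReal.coe_sum]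
    refine Finset.sum_congr rfl fun j _ => ?_
    simp
  have hσ' : (0 : ℝ) < σ := hσ
  have hε : 0 ≤ σ * x * ‖a‖ := by positivity
  have e : -((σ : ℝ) * x * ‖a‖) ^ 2 / (2 * (‖a‖ ^ 2 * (σ : ℝ) ^ 2)) = -x ^ 2 / 2 := by
    field_simp
  have t1 := hsub.measure_ge_le hε
  have t2 := hsub.neg.measure_ge_le hε
  rw [hc, e] at t1 t2
  calc P.real {ω | σ * x * ‖a‖ < |⟪eps ω, a⟫|}
      ≤ P.real ({ω | σ * x * ‖a‖ ≤ ⟪eps ω, a⟫} ∪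
          {ω | σ * x * ‖a‖ ≤ (-fun ω => ⟪eps ω, a⟫) ω}) := by
        refine measureReal_mono (fun ω hω => ?_)
        rcases lt_abs.1 (show σ * x * ‖a‖ < |⟪eps ω, a⟫| from hω) with h | h
        · exact Or.inl h.le
        · exact Or.inr h.le
    _ ≤ _ := (measureReal_union_le _ _).trans (by linarith)

/-- Simultaneous control of finitely many linear functionals of the noise. -/
theorem gaussian_inner_union {σ : NNReal} (hσ : 0 < σ) {eps : Ω → EuclideanSpace ℝ κ}
    (hlaw : ∀ j, HasLaw (fun ω => eps ω j) (gaussianReal 0 (σ ^ 2)) P)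
    (hind : iIndepFun (fun j ω => eps ω j) P) {β : Type*} [Fintype β]
    (a : β → EuclideanSpace ℝ κ) {x : ℝ} (hx : 0 ≤ x) :
    ENNReal.ofReal (1 - 2 * Fintype.card β * Real.exp (-x ^ 2 / 2)) ≤
      P {ω | ∀ i, |⟪eps ω, a i⟫| ≤ σ * x * ‖a i‖} := by
  set G := {ω | ∀ i, |⟪eps ω, a i⟫| ≤ σ * x * ‖a i‖}
  have h1 : P.real Gᶜ ≤ 2 * Fintype.card β * Real.exp (-x ^ 2 / 2) := by
    have hG : Gᶜ ⊆ ⋃ i, {ω | σ * x * ‖a i‖ < |⟪eps ω, a i⟫|} := by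
      intro ω hω
      have : ¬ ∀ i, |⟪eps ω, a i⟫| ≤ σ * x * ‖a i‖ := hω
      push Not at this
      exact Set.mem_iUnion.2 this
    refine (measureReal_mono hG (measure_ne_top _ _)).trans
      ((measureReal_iUnion_fintype_le _).trans ?_)
    refine (Finset.sum_le_sum fun i _ => gaussian_inner_tail hσ hlaw hind (a i) hx).trans ?_
    simp; linarith
  have h2 : 1 ≤ P.real G + P.real Gᶜ := by
    have := measureReal_union_le (μ := P) G Gᶜ
    rwa [Set.union_compl_self, probReal_univ] at this
  rw [ENNReal.ofReal_le_iff_le_toReal (measure_ne_top _ _)]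
  change _ ≤ P.real G
  linarith

end Tail

/-! ### Factorization of the total difference over the coordinates -/

section TensorStructure

/-- The one-dimensional `k`-th order difference. -/
noncomputable def diffOne (k N : ℕ) (u : ℕ → ℝ) (j : ℕ) : ℝ :=
  (N : ℝ) ^ (k - 1) * ∑ l ∈ Finset.range (k + 1), (-1 : ℝ) ^ l * (k.choose l : ℝ) * u (j - l)

theorem diffOne_congr {k N : ℕ} {u v : ℕ → ℝ} {j : ℕ} (hj : k + 1 ≤ j ∧ j ≤ N)
    (h : ∀ t, 1 ≤ t → t ≤ N → u t = v t) : diffOne k N u j = diffOne k N v j := by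
  unfold diffOne
  congr 1
  refine Finset.sum_congr rfl fun l hl => ?_
  have := Finset.mem_range.1 hl
  rw [h (j - l) (by omega) (by omega)]

variable {d : ℕ}

theorem partialDiff_prod (k N : ℕ) (i : Fin d) (u : Fin d → ℕ → ℝ) :
    partialDiff k N i (fun j => ∏ m, u m (j m)) =
      fun j => ∏ m, Function.update u i (diffOne k N (u i)) m (j m) := by
  funext j
  change (N : ℝ) ^ (k - 1) * ∑ l ∈ Finset.range (k + 1),
    (-1 : ℝ) ^ l * (k.choose l : ℝ) * ∏ m, u m (Function.update j i (j i - l) m) = _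
  rw [← Finset.mul_prod_erase Finset.univ _ (Finset.mem_univ i), Function.update_self, diffOne,
    mul_assoc, Finset.sum_mul]
  congr 1
  refine Finset.sum_congr rfl fun l _ => ?_
  rw [← Finset.mul_prod_erase Finset.univ _ (Finset.mem_univ i), Function.update_self, ← mul_assoc]
  congr 1
  refine Finset.prod_congr rfl fun m hm => ?_
  rw [Function.update_of_ne (Finset.ne_of_mem_erase hm),
    Function.update_of_ne (Finset.ne_of_mem_erase hm)]

theorem list_prod_partialDiff_prod (k N : ℕ) (u : Fin d → ℕ → ℝ) (l : List (Fin d))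
    (hl : l.Nodup) :
    (l.map fun i => partialDiff (d := d) k N i).prod (fun j => ∏ m, u m (j m)) =
      fun j => ∏ m, (if m ∈ l then diffOne k N (u m) else u m) (j m) := by
  induction l with
  | nil => simp
  | cons i l ih =>
    have hi := (List.nodup_cons.1 hl).1
    rw [List.map_cons, List.prod_cons, Module.End.mul_apply, ih (List.nodup_cons.1 hl).2,
      partialDiff_prod]
    funext j
    refine Finset.prod_congr rfl fun m _ => ?_
    by_cases hm : m = i
    · subst hm; simp [hi]
    · simp [hm]

/-- The tensor with entries `∏ i, u i (t i)`. -/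
noncomputable def prodTensor (N : ℕ) (u : Fin d → ℕ → ℝ) : Tensor d N :=
  WithLp.toLp 2 fun t => ∏ i, u i (t i)

theorem prodTensor_apply {N : ℕ} (u : Fin d → ℕ → ℝ) (t : Fin d → Finset.Icc 1 N) :
    prodTensor N u t = ∏ i, u i (t i) := rfl

/-- The zero extension is still a product, and at indices in `{k + 1, …, N}` the differences only
read arguments in `{1, …, N}`, so the extension is never seen. -/
theorem vitaliDiff_prodTensor {k N : ℕ} (u : Fin d → ℕ → ℝ) (j : DiffIndex d k N) :
    vitaliDiff k (prodTensor N u) j = ∏ i, diffOne k N (u i) (j i) := by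
  have h0 : zeroExt d N (prodTensor N u) =
      fun j => ∏ i, (fun i x => if x ∈ Finset.Icc 1 N then u i x else 0) i (j i) := by
    funext j
    change (if h : ∀ i, j i ∈ Finset.Icc 1 N then
      prodTensor N u (fun i => ⟨j i, h i⟩) else 0) = _
    split_ifs with h
    · rw [prodTensor_apply]
      exact Finset.prod_congr rfl fun i _ => (if_pos (h i)).symm
    · push Not at h
      obtain ⟨i, hi⟩ := h
      exact (Finset.prod_eq_zero (Finset.mem_univ i) (if_neg hi)).symm
  change ((List.finRange d).map fun i => partialDiff (d := d) k N i).prod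
    (zeroExt d N (prodTensor N u)) (fun i => (j i : ℕ)) = _
  rw [h0, list_prod_partialDiff_prod k N
    (fun i x => if x ∈ Finset.Icc 1 N then u i x else 0) _ (List.nodup_finRange d)]
  refine Finset.prod_congr rfl fun i _ => ?_
  rw [if_pos (List.mem_finRange i)]
  refine diffOne_congr (Finset.mem_Icc.1 (j i).2) fun t h1 h2 => ?_
  exact if_pos (Finset.mem_Icc.2 ⟨h1, h2⟩)

/-- The matrix entries of the one-dimensional difference operator. -/
noncomputable def diffKernel (k N j t : ℕ) : ℝ := diffOne k N (Pi.single t 1) j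

theorem single_eq_prodTensor {N : ℕ} (t : Fin d → Finset.Icc 1 N) :
    EuclideanSpace.single t (1 : ℝ) = prodTensor N (fun i => Pi.single (t i : ℕ) (1 : ℝ)) := by
  ext s
  rw [prodTensor_apply]
  simp only [PiLp.single_apply, Pi.single_apply]
  rw [Finset.prod_ite_zero]
  simp only [Finset.prod_const_one, Finset.mem_univ, true_implies]
  congr 1
  simp only [funext_iff, Subtype.ext_iff]

theorem vitaliDiff_eq_sum {k N : ℕ} (f : Tensor d N) (j : DiffIndex d k N) :
    vitaliDiff k f j = ∑ t, f t * ∏ i, diffKernel k N (j i) (t i) := by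
  have hf : f = ∑ t, f t • EuclideanSpace.single t (1 : ℝ) := by
    ext s
    simp [Pi.single_apply]
  conv_lhs => rw [hf]
  rw [map_sum, Finset.sum_apply]
  refine Finset.sum_congr rfl fun t _ => ?_
  rw [map_smul, Pi.smul_apply, smul_eq_mul, single_eq_prodTensor, vitaliDiff_prodTensor]
  rfl

open scoped RealInnerProductSpace in
/-- Testing the total difference against weights bounds it by the norm of the adjoint. -/
theorem sum_mul_vitaliDiff_le {k N : ℕ} (w : DiffIndex d k N → ℝ) (f : Tensor d N) :
    ∑ j, w j * vitaliDiff k f j ≤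
      √(∑ t : Fin d → Finset.Icc 1 N, (∑ j, w j * ∏ i, diffKernel k N (j i) (t i)) ^ 2) * ‖f‖ := by
  set A : Tensor d N := WithLp.toLp 2 fun t => ∑ j, w j * ∏ i, diffKernel k N (j i) (t i)
  have h1 : ∑ j, w j * vitaliDiff k f j = ⟪A, f⟫ := by
    simp only [vitaliDiff_eq_sum, PiLp.inner_apply, Finset.mul_sum, A]
    rw [Finset.sum_comm]
    refine Finset.sum_congr rfl fun t _ => ?_
    simp only [RCLike.inner_apply, conj_trivial, Finset.mul_sum]
    exact Finset.sum_congr rfl fun j _ => by ring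
  have h2 : ‖A‖ = √(∑ t : Fin d → Finset.Icc 1 N,
      (∑ j, w j * ∏ i, diffKernel k N (j i) (t i)) ^ 2) := by
    rw [EuclideanSpace.norm_eq]
    simp only [Real.norm_eq_abs, sq_abs, A]
  rw [h1, ← h2]
  exact real_inner_le_norm _ _

/-- The difference kernel applied from the left to a function supported in `{k + 1, …, N}`. -/
theorem sum_mul_diffKernel {k N : ℕ} (b : ℤ → ℝ) (t : ℕ)
    (hb : ∀ z : ℤ, b z ≠ 0 → (k : ℤ) + 1 ≤ z ∧ z ≤ N) :
    ∑ j : Finset.Icc (k + 1) N, b (j : ℕ) * diffKernel k N j t =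
      (N : ℝ) ^ (k - 1) * ∑ l ∈ Finset.range (k + 1),
        (-1 : ℝ) ^ l * (k.choose l : ℝ) * b ((t : ℤ) + l) := by
  rw [Finset.sum_coe_sort (Finset.Icc (k + 1) N) (fun j : ℕ => b j * diffKernel k N j t)]
  simp only [diffKernel, diffOne, Finset.mul_sum]
  rw [Finset.sum_comm]
  refine Finset.sum_congr rfl fun l hl => ?_
  have hl' := Finset.mem_range.1 hl
  by_cases h : t + l ∈ Finset.Icc (k + 1) N
  · rw [Finset.sum_eq_single_of_mem (t + l) h]
    · rw [Nat.add_sub_cancel, Pi.single_eq_same]; push_cast; ring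
    · intro j hj hne
      have := Finset.mem_Icc.1 hj
      rw [Pi.single_eq_of_ne (by omega)]; ring
  · have h0 : b ((t : ℤ) + l) = 0 := by
      by_contra hne
      have := hb _ hne
      exact h (Finset.mem_Icc.2 (by omega))
    rw [h0, Finset.sum_eq_zero]
    · ring
    · intro j hj
      have := Finset.mem_Icc.1 hj
      rw [Pi.single_eq_of_ne]
      · ring
      · rintro rfl
        apply h
        rw [Nat.sub_add_cancel (by omega)]
        exact hj

end TensorStructure

/-! ### Truncated polynomials and the distance between an atom and its shifted cuts -/

section Dictionary

/-- The polynomial `(t - x + 1) ⋯ (t - x + k - 1) / (k - 1)!` of degree `k - 1`. -/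
noncomputable def knotPoly (k x t : ℕ) : ℝ :=
  ∏ i ∈ Finset.range (k - 1), ((t : ℝ) - x + (i + 1)) / (i + 1)

/-- The rescaled polynomial with root block ending at `x`, cut off to the left of `a`. -/
noncomputable def truncPoly (k N x a t : ℕ) : ℝ :=
  if a ≤ t then knotPoly k x t / (N : ℝ) ^ (k - 1) else 0

theorem sum_choose_knotPoly {k : ℕ} (hk : 1 ≤ k) (x : ℕ) {j : ℕ} (hj : k ≤ j) :
    ∑ l ∈ Finset.range (k + 1), (-1 : ℝ) ^ l * (k.choose l : ℝ) * knotPoly k x (j - l) = 0 := by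
  set p : Polynomial ℝ := ∏ i ∈ Finset.range (k - 1),
    (Polynomial.C (1 / ((i : ℝ) + 1)) * (Polynomial.X + Polynomial.C ((i : ℝ) + 1 - x))) with hp
  have hdeg : p.natDegree < k := by
    have h1 : p.natDegree ≤ ∑ i ∈ Finset.range (k - 1), 1 := by
      refine (Polynomial.natDegree_prod_le _ _).trans (Finset.sum_le_sum fun i _ => ?_)
      refine (Polynomial.natDegree_C_mul_le _ _).trans ?_
      rw [Polynomial.natDegree_X_add_C]
    simp at h1
    omega
  have heval : ∀ t : ℕ, p.eval (t : ℝ) = knotPoly k x t := by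
    intro t
    simp only [hp, Polynomial.eval_prod, Polynomial.eval_mul, Polynomial.eval_C,
      Polynomial.eval_add, Polynomial.eval_X, knotPoly]
    exact Finset.prod_congr rfl fun i _ => by ring
  have h0 := congrFun (Polynomial.fwdDiff_iter_eq_zero_of_degree_lt hdeg) ((j - k : ℕ) : ℝ)
  rw [fwdDiff_iter_eq_sum_shift, Pi.zero_apply] at h0
  rw [← h0, ← Finset.sum_range_reflect]
  refine Finset.sum_congr rfl fun l hl => ?_
  have hl' := Finset.mem_range.1 hl
  have e1 : k + 1 - 1 - l = k - l := by omega
  have e2 : j - (k - l) = j - k + l := by omega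
  rw [e1, e2, ← heval, Nat.choose_symm (by omega)]
  simp [zsmul_eq_mul]

/-- The difference stencil at `j` reads `j - k, …, j`. If it does not straddle the cut, it sees
either zero or a polynomial of degree below `k`. -/
theorem diffOne_truncPoly_eq_zero {k N x a j : ℕ} (hk : 1 ≤ k) (hj : k + 1 ≤ j)
    (h : j < a ∨ a + k ≤ j) : diffOne k N (truncPoly k N x a) j = 0 := by
  unfold diffOne
  rcases h with h | h
  · rw [Finset.sum_eq_zero, mul_zero]
    intro l _
    rw [truncPoly, if_neg (by omega), mul_zero]
  · have : ∑ l ∈ Finset.range (k + 1), (-1 : ℝ) ^ l * (k.choose l : ℝ) * truncPoly k N x a (j - l) =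
        (∑ l ∈ Finset.range (k + 1), (-1 : ℝ) ^ l * (k.choose l : ℝ) * knotPoly k x (j - l)) /
          (N : ℝ) ^ (k - 1) := by
      rw [Finset.sum_div]
      refine Finset.sum_congr rfl fun l hl => ?_
      have hl' := Finset.mem_range.1 hl
      rw [truncPoly, if_pos (by omega), mul_div_assoc]
    rw [this, sum_choose_knotPoly hk x (by omega), zero_div, mul_zero]

theorem knotPoly_eq_zero {k x t : ℕ} (h1 : t < x) (h2 : x < t + k) : knotPoly k x t = 0 := by
  refine Finset.prod_eq_zero (i := x - t - 1) (Finset.mem_range.2 (by omega)) ?_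
  have : ((x - t - 1 : ℕ) : ℝ) = (x : ℝ) - t - 1 := by
    rw [Nat.cast_sub (by omega), Nat.cast_sub (by omega), Nat.cast_one]
  rw [this, div_eq_zero_iff]
  left; ring

theorem knotPoly_self (k x : ℕ) : knotPoly k x x = 1 := by
  refine Finset.prod_eq_one fun i _ => ?_
  rw [sub_self, zero_add, div_self]
  positivity

/-- The `k - 1` roots are exactly the integers just left of `x`, so the cut may be moved across
them. This shrinks the support of the difference from a block of `k` indices to the single index
`x`. -/
theorem truncPoly_shift {k N x : ℕ} (hk : 1 ≤ k) (hx : k ≤ x) :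
    truncPoly k N x x = truncPoly k N x (x + 1 - k) := by
  funext t
  unfold truncPoly
  by_cases h1 : x ≤ t
  · rw [if_pos h1, if_pos (by omega)]
  · rw [if_neg h1]
    split_ifs with h2
    · rw [knotPoly_eq_zero (by omega) (by omega), zero_div]
    · rfl

theorem diffOne_truncPoly_self {k N x j : ℕ} (hk : 1 ≤ k) (hN : 1 ≤ N) (hx : k + 1 ≤ x)
    (hj : k + 1 ≤ j) : diffOne k N (truncPoly k N x x) j = if j = x then 1 else 0 := by
  split_ifs with h
  · subst h
    unfold diffOne
    rw [Finset.sum_eq_single_of_mem 0 (by simp)]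
    · have : (N : ℝ) ≠ 0 := by positivity
      simp [truncPoly, knotPoly_self]
      field_simp
    · intro l _ hl
      rw [truncPoly, if_neg (by omega), mul_zero]
  · rcases lt_or_gt_of_ne h with h | h
    · exact diffOne_truncPoly_eq_zero hk hj (Or.inl h)
    · rw [truncPoly_shift hk (by omega)]
      exact diffOne_truncPoly_eq_zero hk hj (Or.inr (by omega))

theorem abs_knotPoly_le {k x t : ℕ} {B : ℝ}
    (h : ∀ i : ℕ, |(t : ℝ) - x + (i + 1)| ≤ B * (i + 1)) : |knotPoly k x t| ≤ B ^ (k - 1) := by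
  rw [knotPoly, Finset.abs_prod]
  calc _ ≤ ∏ _i ∈ Finset.range (k - 1), B := by
        refine Finset.prod_le_prod (fun _ _ => abs_nonneg _) fun i _ => ?_
        have : (0 : ℝ) < i + 1 := by positivity
        rw [abs_div, abs_of_pos this, div_le_iff₀ this]
        exact h i
    _ = _ := by simp

theorem abs_truncPoly_le_one {k N x a t : ℕ} (hx : 1 ≤ x ∧ x ≤ N) (ht : 1 ≤ t ∧ t ≤ N) :
    |truncPoly k N x a t| ≤ 1 := by
  have hN : (0 : ℝ) < N := by exact_mod_cast (by omega : 0 < N)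
  unfold truncPoly
  split_ifs
  · rw [abs_div, abs_of_pos (by positivity : (0 : ℝ) < (N : ℝ) ^ (k - 1)),
      div_le_one (by positivity)]
    refine abs_knotPoly_le fun i => ?_
    have h1 : (1 : ℝ) ≤ x := by exact_mod_cast hx.1
    have h2 : (x : ℝ) ≤ N := by exact_mod_cast hx.2
    have h3 : (1 : ℝ) ≤ t := by exact_mod_cast ht.1
    have h4 : (t : ℝ) ≤ N := by exact_mod_cast ht.2
    have h5 : (0 : ℝ) ≤ i := by positivity
    rw [abs_le]
    constructor <;> nlinarith
  · simp

/-- The two truncations disagree only between the cuts, where every factor of the polynomial is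
bounded by `|x - a|`. -/
theorem abs_truncPoly_sub_le {k N x a t : ℕ} (hN : 1 ≤ N) :
    |truncPoly k N x x t - truncPoly k N x a t| ≤ (|(x : ℝ) - a| / N) ^ (k - 1) := by
  have hN' : (0 : ℝ) < N := by exact_mod_cast hN
  rw [div_pow]
  have key : ∀ b c : ℕ, b ≤ t → t < c → (b = x ∧ c = a ∨ b = a ∧ c = x) →
      |knotPoly k x t / (N : ℝ) ^ (k - 1)| ≤ |(x : ℝ) - a| ^ (k - 1) / (N : ℝ) ^ (k - 1) := by
    intro b c hb hc hbc
    rw [abs_div, abs_of_pos (by positivity : (0 : ℝ) < (N : ℝ) ^ (k - 1))]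
    gcongr
    refine abs_knotPoly_le fun i => ?_
    have hi : (0 : ℝ) ≤ i := by positivity
    have hb' : (b : ℝ) ≤ t := by exact_mod_cast hb
    have hc' : (t : ℝ) + 1 ≤ c := by exact_mod_cast hc
    rcases hbc with ⟨rfl, rfl⟩ | ⟨rfl, rfl⟩
    · rw [abs_of_nonpos (by linarith : (b : ℝ) - c ≤ 0), abs_of_nonneg (by linarith)]
      nlinarith
    · rw [abs_of_nonneg (by linarith : (0 : ℝ) ≤ (c : ℝ) - b), abs_le]
      constructor <;> nlinarith
  unfold truncPoly
  split_ifs with h1 h2 h2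
  · rw [sub_self, abs_zero]; positivity
  · rw [sub_zero]; exact key x a h1 (by omega) (Or.inl ⟨rfl, rfl⟩)
  · rw [zero_sub, abs_neg]; exact key a x h2 (by omega) (Or.inr ⟨rfl, rfl⟩)
  · rw [sub_self, abs_zero]; positivity

/-- At most `|x - a|` indices contribute, each the square of a power `k - 1`: hence the exponent `2
(k - 1) + 1`. -/
theorem sum_truncPoly_sub_sq_le {k N x a : ℕ} (hk : 1 ≤ k) (hN : 1 ≤ N) :
    ∑ t : Finset.Icc 1 N, |truncPoly k N x x t - truncPoly k N x a t| ^ 2 ≤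
      N * (|(x : ℝ) - a| / N) ^ (2 * k - 1) := by
  have hN' : (0 : ℝ) < N := by exact_mod_cast hN
  rw [Finset.sum_coe_sort (Finset.Icc 1 N)
    (fun t : ℕ => |truncPoly k N x x t - truncPoly k N x a t| ^ 2)]
  set B := ((|(x : ℝ) - a| / N) ^ (k - 1)) ^ 2 with hB
  have hcard : (((Finset.Icc 1 N).filter (fun t => min x a ≤ t ∧ t < max x a)).card : ℝ) ≤
      |(x : ℝ) - a| := by
    have h1 : ((Finset.Icc 1 N).filter (fun t => min x a ≤ t ∧ t < max x a)).card ≤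
        (Finset.Ico (min x a) (max x a)).card := by
      refine Finset.card_le_card fun t ht => ?_
      simpa using (Finset.mem_filter.1 ht).2
    rw [Nat.card_Ico] at h1
    have h2 : ((max x a - min x a : ℕ) : ℝ) = |(x : ℝ) - a| := by
      rw [Nat.cast_sub (by omega), Nat.cast_max, Nat.cast_min, max_sub_min_eq_abs, abs_sub_comm]
    rw [← h2]
    exact_mod_cast h1
  calc ∑ t ∈ Finset.Icc 1 N, |truncPoly k N x x t - truncPoly k N x a t| ^ 2
      = ∑ t ∈ (Finset.Icc 1 N).filter (fun t => min x a ≤ t ∧ t < max x a),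
          |truncPoly k N x x t - truncPoly k N x a t| ^ 2 := by
        rw [Finset.sum_filter_of_ne]
        intro t _ hne
        by_contra hcon
        apply hne
        have : x ≤ t ↔ a ≤ t := by omega
        unfold truncPoly
        simp only [this, sub_self, abs_zero]
        norm_num
    _ ≤ ∑ _t ∈ (Finset.Icc 1 N).filter (fun t => min x a ≤ t ∧ t < max x a), B :=
        Finset.sum_le_sum fun t _ =>
          pow_le_pow_left₀ (abs_nonneg _) (abs_truncPoly_sub_le hN) 2
    _ ≤ |(x : ℝ) - a| * B := by
        rw [Finset.sum_const, nsmul_eq_mul]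
        exact mul_le_mul_of_nonneg_right hcard (by positivity)
    _ = N * (|(x : ℝ) - a| / N) ^ (2 * k - 1) := by
        have : 2 * k - 1 = (k - 1) * 2 + 1 := by omega
        rw [this, pow_succ, pow_mul, hB]
        field_simp

theorem abs_prod_sub_prod_le {ι : Type*} (s : Finset ι) (a b : ι → ℝ)
    (ha : ∀ i ∈ s, |a i| ≤ 1) (hb : ∀ i ∈ s, |b i| ≤ 1) :
    |∏ i ∈ s, a i - ∏ i ∈ s, b i| ≤ ∑ i ∈ s, |a i - b i| := by
  classical
  induction s using Finset.induction_on with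
  | empty => simp
  | insert i s hi ih =>
    rw [Finset.prod_insert hi, Finset.prod_insert hi, Finset.sum_insert hi]
    have h1 := ih (fun j hj => ha j (Finset.mem_insert_of_mem hj))
      (fun j hj => hb j (Finset.mem_insert_of_mem hj))
    have h2 : |∏ j ∈ s, a j| ≤ 1 := by
      rw [Finset.abs_prod]
      exact Finset.prod_le_one (fun _ _ => abs_nonneg _)
        fun j hj => ha j (Finset.mem_insert_of_mem hj)
    have h3 := hb i (Finset.mem_insert_self i s)
    have e : a i * ∏ j ∈ s, a j - b i * ∏ j ∈ s, b j =
        (a i - b i) * ∏ j ∈ s, a j + b i * (∏ j ∈ s, a j - ∏ j ∈ s, b j) := by ring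
    rw [e]
    refine (abs_add_le _ _).trans ?_
    rw [abs_mul, abs_mul]
    refine add_le_add ?_ ?_
    · exact mul_le_of_le_one_right (abs_nonneg _) h2
    · exact (mul_le_of_le_one_left (abs_nonneg _) h3).trans h1

/-- The free coordinates contribute the cardinality to the power `d - 1`; the extra factor on both
sides avoids that subtraction. -/
theorem card_mul_sum_apply {d : ℕ} {α : Type*} [Fintype α] (F : α → ℝ) (i : Fin d) :
    (Fintype.card α : ℝ) * ∑ t : Fin d → α, F (t i) = (Fintype.card α : ℝ) ^ d * ∑ x, F x := by
  classical
  have h1 : ∀ t : Fin d → α, F (t i) = ∏ l, (if l = i then F (t l) else 1) := by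
    intro t
    rw [Finset.prod_ite_eq' Finset.univ i, if_pos (Finset.mem_univ i)]
  have h2 := Finset.prod_univ_sum (fun _ : Fin d => (Finset.univ : Finset α))
    (fun l x => if l = i then F x else 1)
  rw [Fintype.piFinset_univ] at h2
  simp only [h1]
  rw [← h2, ← Finset.mul_prod_erase Finset.univ _ (Finset.mem_univ i)]
  have h3 : ∏ l ∈ Finset.univ.erase i, ∑ x, (if l = i then F x else 1) =
      (Fintype.card α : ℝ) ^ (d - 1) := by
    rw [Finset.prod_congr rfl (g := fun _ => (Fintype.card α : ℝ))]
    · simp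
    · intro l hl
      simp [Finset.ne_of_mem_erase hl]
  rw [h3]
  have hd : d = d - 1 + 1 := by have := i.2; omega
  conv_rhs => rw [hd, pow_succ]
  simp
  ring

/-- The dictionary atom at `j` is close to the tensor obtained by moving each cut to `a i`. -/
theorem norm_atom_sub_le {d k N : ℕ} (hk : 1 ≤ k) (hN : 1 ≤ N) (j : DiffIndex d k N)
    (a : Fin d → ℕ) :
    ‖prodTensor N (fun i => truncPoly k N (j i) (j i)) -
        prodTensor N (fun i => truncPoly k N (j i) (a i))‖ ≤
      √((N : ℝ) ^ d) * (√d * ∑ i, √((|((j i : ℕ) : ℝ) - a i| / N) ^ (2 * k - 1))) := by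
  have hN' : (0 : ℝ) < N := by exact_mod_cast hN
  set e : Fin d → ℕ → ℝ := fun i t => |truncPoly k N (j i) (j i) t - truncPoly k N (j i) (a i) t|
  have hx : ∀ i, 1 ≤ (j i : ℕ) ∧ (j i : ℕ) ≤ N := fun i => by
    have := Finset.mem_Icc.1 (j i).2; omega
  have h1 : ‖prodTensor N (fun i => truncPoly k N (j i) (j i)) -
      prodTensor N (fun i => truncPoly k N (j i) (a i))‖ ^ 2 ≤
        (N : ℝ) ^ d * (d * ∑ i, (|((j i : ℕ) : ℝ) - a i| / N) ^ (2 * k - 1)) := by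
    rw [EuclideanSpace.norm_sq_eq]
    calc _ ≤ ∑ t : Fin d → Finset.Icc 1 N, (d : ℝ) * ∑ i, e i (t i) ^ 2 := by
          refine Finset.sum_le_sum fun t _ => ?_
          rw [PiLp.sub_apply, prodTensor_apply, prodTensor_apply, Real.norm_eq_abs]
          have h := abs_prod_sub_prod_le Finset.univ (fun i => truncPoly k N (j i) (j i) (t i))
            (fun i => truncPoly k N (j i) (a i) (t i))
            (fun i _ => abs_truncPoly_le_one (hx i) (Finset.mem_Icc.1 (t i).2))
            (fun i _ => abs_truncPoly_le_one (hx i) (Finset.mem_Icc.1 (t i).2))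
          refine (pow_le_pow_left₀ (abs_nonneg _) h 2).trans ?_
          have := sq_sum_le_card_mul_sum_sq (s := Finset.univ) (f := fun i => e i (t i))
          simpa using this
      _ = (d : ℝ) * ∑ i, ∑ t : Fin d → Finset.Icc 1 N, e i (t i) ^ 2 := by
          rw [← Finset.mul_sum, Finset.sum_comm]
      _ ≤ (d : ℝ) * ∑ i, (N : ℝ) ^ d * (|((j i : ℕ) : ℝ) - a i| / N) ^ (2 * k - 1) := by
          refine mul_le_mul_of_nonneg_left (Finset.sum_le_sum fun i _ => ?_) (by positivity)
          have h2 := card_mul_sum_apply (fun x : Finset.Icc 1 N => e i x ^ 2) i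
          have h3 := sum_truncPoly_sub_sq_le (x := j i) (a := a i) hk hN
          simp only [Fintype.card_coe, Nat.card_Icc, Nat.add_sub_cancel] at h2
          refine le_of_mul_le_mul_left ?_ hN'
          rw [h2]
          calc _ ≤ (N : ℝ) ^ d * (N * (|((j i : ℕ) : ℝ) - a i| / N) ^ (2 * k - 1)) :=
                mul_le_mul_of_nonneg_left h3 (by positivity)
            _ = _ := by ring
      _ = _ := by rw [← Finset.mul_sum]; ring
  have h4 : ∑ i, (|((j i : ℕ) : ℝ) - a i| / N) ^ (2 * k - 1) ≤
      (∑ i, √((|((j i : ℕ) : ℝ) - a i| / N) ^ (2 * k - 1))) ^ 2 := by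
    refine le_trans (le_of_eq ?_) (Finset.sum_sq_le_sq_sum_of_nonneg fun i _ => Real.sqrt_nonneg _)
    exact Finset.sum_congr rfl fun i _ => (Real.sq_sqrt (by positivity)).symm
  refine le_of_sq_le_sq (h1.trans ?_) (by positivity)
  rw [mul_pow, mul_pow, Real.sq_sqrt (by positivity), Real.sq_sqrt (by positivity)]
  gcongr

end Dictionary

/-! ### Cutoff and critical spike profiles -/

section Profile

theorem hasDerivAt_fwdDiff_iter {f f' : ℝ → ℝ} (h : ∀ y, HasDerivAt f (f' y) y) (η : ℝ) (n : ℕ)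
    (y : ℝ) : HasDerivAt ((fwdDiff η)^[n] f) ((fwdDiff η)^[n] f' y) y := by
  induction n generalizing f f' with
  | zero => exact h y
  | succ n ih =>
    rw [Function.iterate_succ_apply, Function.iterate_succ_apply]
    refine ih fun z => ?_
    have h1 : HasDerivAt (fun x => f (x + η)) (f' (z + η)) z := (h (z + η)).comp_add_const z η
    exact h1.sub (h z)

/-- Mean value theorem for iterated forward differences. -/
theorem exists_fwdDiff_iter_succ_eq {f f' : ℝ → ℝ} (h : ∀ y, HasDerivAt f (f' y) y) {η : ℝ}
    (hη : 0 < η) (n : ℕ) (y : ℝ) :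
    ∃ ξ, y < ξ ∧ ξ < y + η ∧ (fwdDiff η)^[n + 1] f y = η * (fwdDiff η)^[n] f' ξ := by
  have hd := hasDerivAt_fwdDiff_iter h η n
  obtain ⟨ξ, hξ, e⟩ := exists_hasDerivAt_eq_slope ((fwdDiff η)^[n] f) ((fwdDiff η)^[n] f')
    (lt_add_of_pos_right y hη) (fun z _ => (hd z).continuousAt.continuousWithinAt)
    (fun z _ => hd z)
  refine ⟨ξ, hξ.1, hξ.2, ?_⟩
  rw [e, add_sub_cancel_left, mul_div_cancel₀ _ hη.ne', Function.iterate_succ_apply']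
  rfl

theorem exists_fwdDiff_iter_bound {k : ℕ} {f : ℝ → ℝ} (hf : ContDiff ℝ k f)
    (hs : HasCompactSupport f) :
    ∃ C, 0 < C ∧ ∀ η, 0 < η → ∀ y, |(fwdDiff η)^[k] f y| ≤ C * η ^ k := by
  induction k generalizing f with
  | zero =>
    obtain ⟨C, hC⟩ := hs.exists_bound_of_continuous hf.continuous
    refine ⟨max C 1, by positivity, fun η _ y => ?_⟩
    simpa using Or.inl (hC y)
  | succ k ih =>
    have hf' : ContDiff ℝ ((k : WithTop ℕ∞) + 1) f := by exact_mod_cast hf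
    obtain ⟨hdiff, -, hcd⟩ := contDiff_succ_iff_deriv.1 hf'
    obtain ⟨C, hC, hb⟩ := ih hcd hs.deriv
    refine ⟨C, hC, fun η hη y => ?_⟩
    obtain ⟨ξ, -, -, e⟩ := exists_fwdDiff_iter_succ_eq (fun z => (hdiff z).hasDerivAt) hη k y
    rw [e, abs_mul, abs_of_pos hη, pow_succ]
    calc _ ≤ η * (C * η ^ k) := mul_le_mul_of_nonneg_left (hb η hη ξ) hη.le
      _ = _ := by ring

/-- Products of a smooth bump and a function with square root growth have increments of the order
of those of the square root. -/
theorem exists_fwdDiff_mul_sqrt_bound {φ s : ℝ → ℝ} (hφ : ContDiff ℝ 1 φ)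
    (hs : HasCompactSupport φ) (h0 : ∀ y, |y| ≥ 1 → φ y = 0) (hs1 : ∀ y, |s y| = √|y|)
    (hs2 : ∀ a b, |s a - s b| * (√|a| + √|b|) ≤ 2 * |a - b|) :
    ∃ C, 0 < C ∧ ∀ η, 0 < η → η ≤ 1 → ∀ y,
      |fwdDiff η (fun x => φ x * s x) y| ≤ C * η * (1 + 1 / √(|y| + η)) := by
  obtain ⟨C, hC, hb⟩ := exists_fwdDiff_iter_bound (k := 1) (by exact_mod_cast hφ) hs
  obtain ⟨B, hB⟩ := hs.exists_bound_of_continuous hφ.continuous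
  have hB0 : 0 ≤ B := (norm_nonneg _).trans (hB 0)
  refine ⟨C * 2 + B * 4, by positivity, fun η hη hη1 y => ?_⟩
  have e : fwdDiff η (fun x => φ x * s x) y =
      φ (y + η) * (s (y + η) - s y) + fwdDiff η φ y * s y := by
    simp only [fwdDiff]; ring
  have hR : 0 < √(|y| + η) := Real.sqrt_pos.2 (by positivity)
  have t1 : |s (y + η) - s y| ≤ 4 * η / √(|y| + η) := by
    rw [le_div_iff₀ hR]
    have h1 := hs2 (y + η) y
    rw [add_sub_cancel_left, abs_of_pos hη] at h1
    have h2 : √(|y| + η) ≤ 2 * (√|y + η| + √|y|) := by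
      rw [Real.sqrt_le_left (by positivity)]
      have a1 := Real.sq_sqrt (abs_nonneg (y + η))
      have a2 := Real.sq_sqrt (abs_nonneg y)
      have a3 : η ≤ |y + η| + |y| := by
        have := abs_sub (y + η) y
        rw [add_sub_cancel_left, abs_of_pos hη] at this
        exact this
      have a4 := Real.sqrt_nonneg |y + η|
      have a5 := Real.sqrt_nonneg |y|
      nlinarith [mul_nonneg a4 a5, abs_nonneg (y + η)]
    calc _ ≤ |s (y + η) - s y| * (2 * (√|y + η| + √|y|)) :=
          mul_le_mul_of_nonneg_left h2 (abs_nonneg _)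
      _ ≤ _ := by linarith
  have t2 : |fwdDiff η φ y * s y| ≤ C * η * 2 := by
    rw [abs_mul, hs1]
    -- Beyond `2`, both `y` and `y + η` lie outside the support, as `η ≤ 1`.
    by_cases hy : |y| ≤ 2
    · have h1 : √|y| ≤ 2 := by
        rw [Real.sqrt_le_left (by norm_num)]; linarith
      have h2 := hb η hη y
      rw [Function.iterate_one, pow_one] at h2
      gcongr
    · have h1 : fwdDiff η φ y = 0 := by
        simp only [fwdDiff]
        have h3 : 1 ≤ |y + η| := by
          have := abs_sub_abs_le_abs_sub y (-η)
          rw [abs_neg, abs_of_pos hη, sub_neg_eq_add] at this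
          linarith
        rw [h0 _ h3, h0 y (by linarith), sub_zero]
      rw [h1, abs_zero, zero_mul]
      positivity
  rw [e]
  calc |φ (y + η) * (s (y + η) - s y) + fwdDiff η φ y * s y|
      ≤ B * (4 * η / √(|y| + η)) + C * η * 2 := by
        refine (abs_add_le _ _).trans (add_le_add ?_ t2)
        rw [abs_mul]
        exact mul_le_mul (hB _) t1 (abs_nonneg _) hB0
    _ ≤ (C * 2 + B * 4) * η * (1 + 1 / √(|y| + η)) := by
        have e2 : (C * 2 + B * 4) * η * (1 + 1 / √(|y| + η)) -
            (B * (4 * η / √(|y| + η)) + C * η * 2) = B * 4 * η + C * 2 * η / √(|y| + η) := by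
          ring
        have : 0 ≤ B * 4 * η + C * 2 * η / √(|y| + η) := by positivity
        linarith

theorem sqrt_abs_increment (a b : ℝ) :
    abs (√|a| - √|b|) * (√|a| + √|b|) ≤ 2 * |a - b| := by
  have h1 : abs (√|a| - √|b|) * (√|a| + √|b|) = abs (|a| - |b|) := by
    have h2 : abs (√|a| + √|b|) = √|a| + √|b| := abs_of_nonneg (by positivity)
    rw [← h2, ← abs_mul]
    congr 1
    have a1 := Real.sq_sqrt (abs_nonneg a)
    have a2 := Real.sq_sqrt (abs_nonneg b)
    nlinarith
  rw [h1]
  linarith [abs_abs_sub_abs_le_abs_sub a b, abs_nonneg (a - b)]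

/-- The odd square root. -/
noncomputable def signedSqrt (y : ℝ) : ℝ := SignType.sign y * √|y|

theorem abs_signedSqrt (y : ℝ) : |signedSqrt y| = √|y| := by
  unfold signedSqrt
  rcases lt_trichotomy y 0 with h | h | h
  · simp [sign_neg h]
  · simp [h]
  · simp [sign_pos h]

theorem signedSqrt_increment (a b : ℝ) :
    |signedSqrt a - signedSqrt b| * (√|a| + √|b|) ≤ 2 * |a - b| := by
  have same := sqrt_abs_increment a b
  have opp : (√|a| + √|b|) * (√|a| + √|b|) ≤ 2 * (|a| + |b|) := by
    have a1 := Real.sq_sqrt (abs_nonneg a)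
    have a2 := Real.sq_sqrt (abs_nonneg b)
    nlinarith [sq_nonneg (√|a| - √|b|)]
  have hnn : 0 ≤ √|a| + √|b| := by positivity
  unfold signedSqrt
  rcases lt_trichotomy a 0 with ha | ha | ha <;> rcases lt_trichotomy b 0 with hb | hb | hb
  · simp only [sign_neg ha, sign_neg hb, SignType.coe_neg_one]
    rw [show -1 * √|a| - -1 * √|b| = -(√|a| - √|b|) by ring, abs_neg]
    exact same
  · subst hb
    simp only [sign_neg ha, sign_zero, SignType.coe_neg_one, SignType.coe_zero]
    rw [show -1 * √|a| - 0 * √|0| = -(√|a| - √|0|) by simp, abs_neg]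
    exact same
  · simp only [sign_neg ha, sign_pos hb, SignType.coe_neg_one, SignType.coe_one]
    rw [show -1 * √|a| - 1 * √|b| = -(√|a| + √|b|) by ring, abs_neg, abs_of_nonneg hnn]
    refine opp.trans (le_of_eq ?_)
    rw [abs_of_neg ha, abs_of_pos hb, abs_of_neg (by linarith)]; ring
  · subst ha
    simp only [sign_neg hb, sign_zero, SignType.coe_neg_one, SignType.coe_zero]
    rw [show 0 * √|0| - -1 * √|b| = -(√|0| - √|b|) by simp, abs_neg]
    exact same
  · subst ha; subst hb; simp
  · subst ha
    simp only [sign_pos hb, sign_zero, SignType.coe_one, SignType.coe_zero]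
    rw [show 0 * √|0| - 1 * √|b| = (√|0| - √|b|) by simp]
    exact same
  · simp only [sign_neg hb, sign_pos ha, SignType.coe_neg_one, SignType.coe_one]
    rw [show 1 * √|a| - -1 * √|b| = (√|a| + √|b|) by ring, abs_of_nonneg hnn]
    refine opp.trans (le_of_eq ?_)
    rw [abs_of_neg hb, abs_of_pos ha, abs_of_pos (by linarith)]; ring
  · subst hb
    simp only [sign_pos ha, sign_zero, SignType.coe_one, SignType.coe_zero]
    rw [show 1 * √|a| - 0 * √|0| = (√|a| - √|0|) by simp]
    exact same
  · simp only [sign_pos ha, sign_pos hb, SignType.coe_one]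
    rw [show 1 * √|a| - 1 * √|b| = (√|a| - √|b|) by ring]
    exact same

/-- The function `|y| ^ (3 / 2)`. -/
noncomputable def absSqrt (y : ℝ) : ℝ := |y| ^ (3 / 2 : ℝ)

theorem contDiff_absSqrt : ContDiff ℝ 1 absSqrt :=
  contDiff_norm_rpow (E := ℝ) (by norm_num)

theorem hasDerivAt_absSqrt (y : ℝ) : HasDerivAt absSqrt (3 / 2 * signedSqrt y) y := by
  have h := hasDerivAt_abs_rpow y (p := 3 / 2) (by norm_num)
  convert! h using 1
  rcases lt_trichotomy y 0 with hy | hy | hy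
  · have h1 : |y| ^ (3 / 2 - 2 : ℝ) * |y| = |y| ^ (1 / 2 : ℝ) := by
      have := Real.rpow_add (abs_pos.2 hy.ne) (3 / 2 - 2) 1
      rw [Real.rpow_one] at this
      rw [← this]; norm_num
    rw [signedSqrt, sign_neg hy, Real.sqrt_eq_rpow, ← h1, abs_of_neg hy]
    simp
    ring
  · subst hy; simp [signedSqrt]
  · have h1 : |y| ^ (3 / 2 - 2 : ℝ) * |y| = |y| ^ (1 / 2 : ℝ) := by
      have := Real.rpow_add (abs_pos.2 hy.ne') (3 / 2 - 2) 1
      rw [Real.rpow_one] at this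
      rw [← this]; norm_num
    rw [signedSqrt, sign_pos hy, Real.sqrt_eq_rpow, ← h1, abs_of_pos hy]
    simp
    ring

theorem absSqrt_eq (y : ℝ) : absSqrt y = √(|y| ^ 3) := by
  rw [absSqrt, Real.sqrt_eq_rpow, ← Real.rpow_natCast, ← Real.rpow_mul (abs_nonneg y)]
  norm_num

/-- Smooth cutoff `φ` and critical spike `α ≤ 1 - |y| ^ (k - 1 / 2)`, with bounds on their `k`-th
differences. -/
theorem exists_profile {k : ℕ} (hk : 1 ≤ k) : ∃ (α φ : ℝ → ℝ) (C : ℝ), 0 < C ∧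
    α 0 = 1 ∧ φ 0 = 1 ∧ (∀ y, 0 ≤ α y) ∧ (∀ y, 0 ≤ φ y) ∧ (∀ y, φ y ≤ 1) ∧
    (∀ y, 1 ≤ |y| → α y = 0) ∧ (∀ y, 1 ≤ |y| → φ y = 0) ∧
    (∀ y, |y| ≤ 1 → α y ≤ 1 - √(|y| ^ (2 * k - 1))) ∧
    (∀ η, 0 < η → η ≤ 1 → ∀ y, |(fwdDiff η)^[k] φ y| ≤ C * η ^ k) ∧
    (∀ η, 0 < η → η ≤ 1 → ∀ y, |(fwdDiff η)^[k] α y| ≤ C * η ^ k * (1 + 1 / √(|y| + η))) := by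
  let b : ContDiffBump (0 : ℝ) := ⟨1 / 2, 1, by norm_num, by norm_num⟩
  set φ : ℝ → ℝ := fun y => b y with hφ
  have hφ0 : φ 0 = 1 := b.one_of_mem_closedBall (by simp [b])
  have hφn : ∀ y, 0 ≤ φ y := fun y => b.nonneg
  have hφ1 : ∀ y, φ y ≤ 1 := fun y => b.le_one
  have hφz : ∀ y, 1 ≤ |y| → φ y = 0 := fun y hy => b.zero_of_le_dist (by simpa [b] using hy)
  have hφs : HasCompactSupport φ := b.hasCompactSupport
  have hφc : ∀ m : ℕ, ContDiff ℝ m φ := fun m => b.contDiff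
  obtain ⟨C0, hC0, hb0⟩ := exists_fwdDiff_iter_bound (hφc k) hφs
  -- The spike is `α = φ * (1 - h)`, so only the difference bound for `φ * h` depends on the choice
  -- of `h`.
  have main : ∀ h : ℝ → ℝ, h 0 = 0 → (∀ y, |y| ≤ 1 → √(|y| ^ (2 * k - 1)) ≤ h y) →
      (∀ y, |y| ≤ 1 → h y ≤ 1) →
      (∃ C, 0 < C ∧ ∀ η, 0 < η → η ≤ 1 → ∀ y,
        |(fwdDiff η)^[k] (fun y => φ y * h y) y| ≤ C * η ^ k * (1 + 1 / √(|y| + η))) →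
      ∃ (α φ : ℝ → ℝ) (C : ℝ), 0 < C ∧
        α 0 = 1 ∧ φ 0 = 1 ∧ (∀ y, 0 ≤ α y) ∧ (∀ y, 0 ≤ φ y) ∧ (∀ y, φ y ≤ 1) ∧
        (∀ y, 1 ≤ |y| → α y = 0) ∧ (∀ y, 1 ≤ |y| → φ y = 0) ∧
        (∀ y, |y| ≤ 1 → α y ≤ 1 - √(|y| ^ (2 * k - 1))) ∧
        (∀ η, 0 < η → η ≤ 1 → ∀ y, |(fwdDiff η)^[k] φ y| ≤ C * η ^ k) ∧
        (∀ η, 0 < η → η ≤ 1 → ∀ y,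
          |(fwdDiff η)^[k] α y| ≤ C * η ^ k * (1 + 1 / √(|y| + η))) := by
    rintro h h0 hlow hup ⟨C1, hC1, hb1⟩
    refine ⟨fun y => φ y * (1 - h y), φ, C0 + C1, by positivity, by simp [hφ0, h0], hφ0, ?_, hφn,
      hφ1, ?_, hφz, ?_, ?_, ?_⟩
    · intro y
      by_cases hy : |y| ≤ 1
      · exact mul_nonneg (hφn y) (by linarith [hup y hy])
      · simp [hφz y (by linarith)]
    · intro y hy; simp [hφz y hy]
    · intro y hy
      have h1 := hup y hy
      have h2 := hlow y hy
      calc φ y * (1 - h y) ≤ 1 * (1 - h y) :=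
            mul_le_mul_of_nonneg_right (hφ1 y) (by linarith)
        _ ≤ _ := by linarith
    · intro η hη _ y
      refine (hb0 η hη y).trans ?_
      gcongr
      linarith
    · intro η hη hη1 y
      have e : (fun y => φ y * (1 - h y)) = φ + (-1 : ℝ) • (fun y => φ y * h y) := by
        funext y
        simp only [Pi.add_apply, Pi.smul_apply, smul_eq_mul]
        ring
      rw [e, fwdDiff_iter_add, fwdDiff_iter_const_smul, Pi.add_apply, Pi.smul_apply, smul_eq_mul,
        add_mul, add_mul]
      refine (abs_add_le _ _).trans (add_le_add ?_ ?_)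
      · refine (hb0 η hη y).trans (le_mul_of_one_le_right (by positivity) ?_)
        have : 0 ≤ 1 / √(|y| + η) := by positivity
        linarith
      · rw [neg_one_mul, abs_neg]
        exact hb1 η hη hη1 y
  -- For `k = 1, 2` take `h = |y| ^ (k - 1 / 2)` itself, singular at the origin. For `k ≥ 3` the
  -- smooth `y ^ 2` already dominates it on `|y| ≤ 1`, because `2 k - 1 ≥ 4`.
  rcases (by omega : k = 1 ∨ k = 2 ∨ 3 ≤ k) with rfl | rfl | hk3
  · refine main (fun y => √|y|) (by simp) (by simp) (fun y hy => Real.sqrt_le_one.2 hy) ?_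
    obtain ⟨C, hC, hb⟩ := exists_fwdDiff_mul_sqrt_bound (hφc 1) hφs hφz
      (s := fun y => √|y|) (fun y => abs_of_nonneg (Real.sqrt_nonneg _)) sqrt_abs_increment
    refine ⟨C, hC, fun η hη hη1 y => ?_⟩
    rw [Function.iterate_one, pow_one]
    exact hb η hη hη1 y
  · refine main absSqrt (by simp [absSqrt]) (fun y _ => (absSqrt_eq y).ge)
      (fun y hy => Real.rpow_le_one (abs_nonneg y) hy (by norm_num)) ?_
    have hφ' : ContDiff ℝ 1 (deriv φ) := by
      have h2 : ContDiff ℝ ((1 : WithTop ℕ∞) + 1) φ := b.contDiff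
      exact (contDiff_succ_iff_deriv.1 h2).2.2
    have hφd : ∀ y, HasDerivAt φ (deriv φ y) y := fun y =>
      (((hφc 1).differentiable (by simp)) y).hasDerivAt
    have hcs1 : HasCompactSupport (fun y => deriv φ y * absSqrt y) := hφs.deriv.mul_right
    have hcd1 : ContDiff ℝ (1 : ℕ) (fun y => deriv φ y * absSqrt y) := by
      exact_mod_cast hφ'.mul contDiff_absSqrt
    obtain ⟨C1, hC1, hb1⟩ := exists_fwdDiff_iter_bound hcd1 hcs1
    obtain ⟨C, hC, hb⟩ := exists_fwdDiff_mul_sqrt_bound (hφc 1) hφs hφz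
      abs_signedSqrt signedSqrt_increment
    refine ⟨C1 + 3 * C, by positivity, fun η hη hη1 y => ?_⟩
    have hder : ∀ y, HasDerivAt (fun y => φ y * absSqrt y)
        (((fun y => deriv φ y * absSqrt y) + (3 / 2 : ℝ) • fun y => φ y * signedSqrt y) y) y := by
      intro y
      convert! (hφd y).mul (hasDerivAt_absSqrt y) using 1
      simp only [Pi.add_apply, Pi.smul_apply, smul_eq_mul]
      ring
    obtain ⟨ξ, hξ1, hξ2, e⟩ := exists_fwdDiff_iter_succ_eq hder hη 1 y
    rw [e, fwdDiff_iter_add, fwdDiff_iter_const_smul, Pi.add_apply, Pi.smul_apply, smul_eq_mul]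
    have t1 := hb1 η hη ξ
    have t2 := hb η hη hη1 ξ
    rw [Function.iterate_one, pow_one] at t1
    rw [Function.iterate_one]
    have hR : 0 < √(|y| + η) := Real.sqrt_pos.2 (by positivity)
    -- The mean value point `ξ` is within `η` of `y`, so returning to `y` costs only a constant.
    have t3 : 1 / √(|ξ| + η) ≤ 2 * (1 / √(|y| + η)) := by
      rw [mul_one_div, div_le_div_iff₀ (Real.sqrt_pos.2 (by positivity)) hR, one_mul,
        Real.sqrt_le_left (by positivity), mul_pow, Real.sq_sqrt (by positivity)]
      have : |y| ≤ |ξ| + η := by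
        have := abs_sub_abs_le_abs_sub y ξ
        have h4 : |y - ξ| ≤ η := by rw [abs_le]; constructor <;> linarith
        linarith
      linarith [abs_nonneg ξ]
    have t4 : |fwdDiff η (fun y => φ y * signedSqrt y) ξ| ≤
        2 * C * η * (1 + 1 / √(|y| + η)) := by
      refine t2.trans ?_
      rw [show 2 * C * η * (1 + 1 / √(|y| + η)) = C * η * (2 + 2 * (1 / √(|y| + η))) by ring]
      gcongr
      norm_num
    have hone : 0 ≤ 1 / √(|y| + η) := by positivity
    rw [abs_mul, abs_of_pos hη]
    calc _ ≤ η * (C1 * η + 3 / 2 * (2 * C * η * (1 + 1 / √(|y| + η)))) := by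
          gcongr
          refine (abs_add_le _ _).trans (add_le_add t1 ?_)
          rw [abs_mul, abs_of_pos (by norm_num : (0 : ℝ) < 3 / 2)]
          gcongr
      _ ≤ _ := by
          have : C1 * η * η ≤ C1 * η * η * (1 + 1 / √(|y| + η)) :=
            le_mul_of_one_le_right (by positivity) (by linarith)
          linarith [this]
  · refine main (fun y => y ^ 2) (by simp) (fun y hy => ?_) (fun y hy => ?_) ?_
    · rw [Real.sqrt_le_left (by positivity), ← sq_abs y, ← pow_mul]
      exact pow_le_pow_of_le_one (abs_nonneg y) hy (by omega)
    · rw [← sq_abs y]; exact pow_le_one₀ (abs_nonneg y) hy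
    · have hc : ContDiff ℝ k (fun y => φ y * y ^ 2) := (hφc k).mul (contDiff_id.pow 2)
      have hs : HasCompactSupport (fun y => φ y * y ^ 2) := hφs.mul_right
      obtain ⟨C, hC, hb⟩ := exists_fwdDiff_iter_bound hc hs
      refine ⟨C, hC, fun η hη _ y => (hb η hη y).trans
        (le_mul_of_one_le_right (by positivity) ?_)⟩
      have : 0 ≤ 1 / √(|y| + η) := by positivity
      linarith

end Profile

/-! ### One coordinate: separated knots and the energy of the bumps around them -/

section GridLine

/-- Knots `k + 1 = τ 0 < τ 1 < ⋯ < τ (r + 1) = N` such that the integer intervals of radius `< L`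
around the knots are disjoint and contained in `{k + 1, …, N}`. -/
structure GridLine (k N r L : ℕ) (τ : ℕ → ℕ) : Prop where
  left : τ 0 = k + 1
  right : τ (r + 1) = N
  radius_pos : 1 ≤ L
  radius : ∀ m ≤ r, τ m + 2 * L ≤ τ (m + 1) + 1
  gap : ∀ m, 1 ≤ m → m < r → τ m + k + 1 ≤ τ (m + 1)

variable {k N r L : ℕ} {τ : ℕ → ℕ}

theorem GridLine.strict (h : GridLine k N r L τ) {m m' : ℕ} (hm : m < m') (hm' : m' ≤ r + 1) :
    τ m + 2 * L ≤ τ m' + 1 := by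
  have hL := h.radius_pos
  induction m', hm using Nat.le_induction with
  | base => exact h.radius m (by omega)
  | succ p hp ih =>
    have h1 := ih (by omega)
    have h2 := h.radius p (by omega)
    omega

theorem GridLine.eq_of_close (h : GridLine k N r L τ) {m m' : ℕ} (hm : m ≤ r + 1)
    (hm' : m' ≤ r + 1) (hd : |(τ m : ℤ) - τ m'| < L) : m = m' := by
  have hL := h.radius_pos
  rw [abs_lt] at hd
  rcases lt_trichotomy m m' with hlt | heq | hlt
  · have := h.strict hlt hm'
    omega
  · exact heq
  · have := h.strict hlt hm
    omega

theorem GridLine.eq_of_close_both (h : GridLine k N r L τ) {m m' : ℕ} (hm : m ≤ r + 1)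
    (hm' : m' ≤ r + 1) {x : ℤ} (h1 : |x - τ m| < L) (h2 : |x - τ m'| < L) : m = m' := by
  have hL := h.radius_pos
  rw [abs_lt] at h1 h2
  rcases lt_trichotomy m m' with hlt | heq | hlt
  · have := h.strict hlt hm'
    omega
  · exact heq
  · have := h.strict hlt hm
    omega

theorem GridLine.mem_of_close (h : GridLine k N r L τ) {m : ℕ} (hm1 : 1 ≤ m) (hm : m ≤ r) {z : ℤ}
    (hz : |z - τ m| < L) : (k : ℤ) + 1 ≤ z ∧ z ≤ N := by
  have hL := h.radius_pos
  rw [abs_lt] at hz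
  have h1 := h.strict (show 0 < m by omega) (by omega)
  have h2 := h.strict (show m < r + 1 by omega) le_rfl
  rw [h.left] at h1
  rw [h.right] at h2
  omega

/-- Successive interior knots are at least `k + 1 ≥ 2` apart. This keeps `N / r`, and later `log (n
/ s)`, bounded away from its degenerate value, so that constants can be absorbed into the logarithm.
-/
theorem GridLine.two_mul_le (h : GridLine k N r L τ) (hk : 1 ≤ k) (hr : 1 ≤ r) : 2 * r ≤ N := by
  have hL := h.radius_pos
  have key : ∀ m, 1 ≤ m → m ≤ r → 2 * m + 1 ≤ τ m := by
    intro m hm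
    induction m, hm using Nat.le_induction with
    | base =>
      intro _
      have := h.radius 0 (by omega)
      rw [h.left] at this
      simp at this
      omega
    | succ p hp ih =>
      intro hle
      have h1 := ih (by omega)
      have h2 := h.gap p hp (by omega)
      omega
  have h1 := key r hr le_rfl
  have h2 := h.radius r le_rfl
  rw [h.right] at h2
  omega

/-- The adjoint difference of the bump `β` of radius `L` around the knot `τ m`. -/
noncomputable def bumpDiff (k N L : ℕ) (τ : ℕ → ℕ) (β : ℝ → ℝ) (t m : ℕ) : ℝ :=
  ∑ j : Finset.Icc (k + 1) N, β (((j : ℕ) - τ m : ℝ) / L) * diffKernel k N j t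

/-- A bump around an interior knot fits inside the index range, so the adjoint has no boundary
terms. -/
theorem GridLine.bumpDiff_eq (h : GridLine k N r L τ) {β : ℝ → ℝ} (hβ : ∀ y, 1 ≤ |y| → β y = 0)
    {m : ℕ} (hm1 : 1 ≤ m) (hm : m ≤ r) (t : ℕ) :
    bumpDiff k N L τ β t m = (N : ℝ) ^ (k - 1) * ∑ l ∈ Finset.range (k + 1),
      (-1 : ℝ) ^ l * (k.choose l : ℝ) * β (((t : ℝ) + l - τ m) / L) := by
  have hL : (0 : ℝ) < L := by exact_mod_cast h.radius_pos
  have h1 := sum_mul_diffKernel (k := k) (N := N) (fun z : ℤ => β (((z : ℝ) - τ m) / L)) t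
    (fun z hz => by
      refine h.mem_of_close hm1 hm ?_
      by_contra hcon
      refine hz (hβ _ ?_)
      rw [abs_div, abs_of_pos hL, one_le_div hL]
      have : (L : ℤ) ≤ |z - τ m| := not_lt.1 hcon
      exact_mod_cast this)
  simpa [bumpDiff] using h1

/-- The adjoint of a backward difference is, up to sign, a forward difference; in the rescaled
variable its step is `1 / L`. -/
theorem GridLine.abs_bumpDiff (h : GridLine k N r L τ) {β : ℝ → ℝ} (hβ : ∀ y, 1 ≤ |y| → β y = 0)
    {m : ℕ} (hm1 : 1 ≤ m) (hm : m ≤ r) (t : ℕ) :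
    |bumpDiff k N L τ β t m| =
      (N : ℝ) ^ (k - 1) * |(fwdDiff (1 / (L : ℝ)))^[k] β (((t : ℝ) - τ m) / L)| := by
  have hL : (0 : ℝ) < L := by exact_mod_cast h.radius_pos
  rw [h.bumpDiff_eq hβ hm1 hm, abs_mul, abs_of_nonneg (by positivity), fwdDiff_iter_eq_sum_shift]
  congr 1
  have e : ∑ l ∈ Finset.range (k + 1), (-1 : ℝ) ^ l * (k.choose l : ℝ) *
      β (((t : ℝ) + l - τ m) / L) = (-1) ^ k * ∑ l ∈ Finset.range (k + 1),
        ((-1 : ℤ) ^ (k - l) * (k.choose l : ℤ)) • β (((t : ℝ) - τ m) / L + l • (1 / (L : ℝ))) := by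
    rw [Finset.mul_sum]
    refine Finset.sum_congr rfl fun l hl => ?_
    have hl' := Finset.mem_range.1 hl
    have e1 : ((t : ℝ) - τ m) / L + l • (1 / (L : ℝ)) = ((t : ℝ) + l - τ m) / L := by
      rw [nsmul_eq_mul]; ring
    have e2 : (-1 : ℝ) ^ k * (-1) ^ (k - l) = (-1) ^ l := by
      rw [← pow_add, show k + (k - l) = l + 2 * (k - l) by omega, pow_add, pow_mul]
      norm_num
    rw [e1, zsmul_eq_mul]
    push_cast
    rw [← e2]
    ring
  rw [e, abs_mul, abs_pow, abs_neg, abs_one, one_pow, one_mul]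

theorem GridLine.close_of_bumpDiff_ne_zero (h : GridLine k N r L τ) {β : ℝ → ℝ}
    (hβ : ∀ y, 1 ≤ |y| → β y = 0) {m : ℕ} (hm1 : 1 ≤ m) (hm : m ≤ r) {t : ℕ}
    (hne : bumpDiff k N L τ β t m ≠ 0) : τ m < t + L + k ∧ t < τ m + L := by
  have hL : (0 : ℝ) < L := by exact_mod_cast h.radius_pos
  rw [h.bumpDiff_eq hβ hm1 hm] at hne
  obtain ⟨l, hl, hne'⟩ := Finset.exists_ne_zero_of_sum_ne_zero (right_ne_zero_of_mul hne)
  have hl' := Finset.mem_range.1 hl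
  have h1 : |((t : ℝ) + l - τ m) / L| < 1 := by
    by_contra hcon
    exact right_ne_zero_of_mul hne' (hβ _ (not_lt.1 hcon))
  rw [abs_div, abs_of_pos hL, div_lt_one hL] at h1
  have h2 : |(t : ℤ) + l - τ m| < L := by exact_mod_cast h1
  rw [abs_lt] at h2
  omega

/-- Differencing widens the bumps by `k` to the left, so neighbours may overlap. Knots two labels
apart are at least `2 * L + k` apart, by `gap` for one step and `radius` for the next, which
excludes a third bump. -/
theorem GridLine.overlap_le (h : GridLine k N r L τ) {β : ℝ → ℝ}
    (hβ : ∀ y, 1 ≤ |y| → β y = 0) (t : ℕ) :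
    ((Finset.Icc 1 r).filter fun m => bumpDiff k N L τ β t m ≠ 0).card ≤ 2 := by
  set F := (Finset.Icc 1 r).filter fun m => bumpDiff k N L τ β t m ≠ 0 with hF
  rcases F.eq_empty_or_nonempty with he | hne
  · rw [he]; simp
  · have hmem : ∀ m ∈ F, 1 ≤ m ∧ m ≤ r ∧ τ m < t + L + k ∧ t < τ m + L := by
      intro m hm
      obtain ⟨h1, h2⟩ := Finset.mem_filter.1 hm
      have h3 := Finset.mem_Icc.1 h1
      exact ⟨h3.1, h3.2, h.close_of_bumpDiff_ne_zero hβ h3.1 h3.2 h2⟩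
    have hsub : F ⊆ Finset.Icc (F.min' hne) (F.min' hne + 1) := by
      intro m hm
      refine Finset.mem_Icc.2 ⟨F.min'_le m hm, ?_⟩
      by_contra hcon
      have ha := hmem _ (F.min'_mem hne)
      have hb := hmem m hm
      set a := F.min' hne
      have g1 := h.gap a ha.1 (by omega)
      have g2 := h.strict (show a + 1 < m by omega) (by omega)
      omega
    refine (Finset.card_le_card hsub).trans ?_
    rw [Nat.card_Icc]
    omega

theorem sum_range_inv_succ_le (n : ℕ) :
    ∑ u ∈ Finset.range n, 1 / ((u : ℝ) + 1) ≤ 1 + Real.log n := by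
  have h := harmonic_le_one_add_log n
  rw [harmonic] at h
  push_cast at h
  simpa using h

/-- Each distance to `τ0` occurs at most once on either side. -/
theorem sum_natAbs_le {N τ0 M : ℕ} (H : ℕ → ℝ) (hH : ∀ u, 0 ≤ H u) :
    ∑ t ∈ (Finset.Icc 1 N).filter (fun t : ℕ => ((t : ℤ) - τ0).natAbs < M),
      H (((t : ℤ) - τ0).natAbs) ≤ 2 * ∑ u ∈ Finset.range M, H u := by
  set T := (Finset.Icc 1 N).filter (fun t : ℕ => ((t : ℤ) - τ0).natAbs < M) with hT
  have hlt : ∀ t ∈ T, ((t : ℤ) - τ0).natAbs < M := fun t ht => (Finset.mem_filter.1 ht).2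
  rw [← Finset.sum_filter_add_sum_filter_not T (fun t => τ0 ≤ t), two_mul]
  refine add_le_add ?_ ?_
  · rw [← Finset.sum_image (s := T.filter fun t => τ0 ≤ t)
      (g := fun t : ℕ => ((t : ℤ) - τ0).natAbs) (f := H)]
    · refine Finset.sum_le_sum_of_subset_of_nonneg ?_ fun u _ _ => hH u
      intro u hu
      obtain ⟨t, ht, rfl⟩ := Finset.mem_image.1 hu
      exact Finset.mem_range.2 (hlt t (Finset.mem_filter.1 ht).1)
    · intro a ha b hb hab
      have ha' := (Finset.mem_filter.1 ha).2
      have hb' := (Finset.mem_filter.1 hb).2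
      simp only at hab
      omega
  · rw [← Finset.sum_image (s := T.filter fun t => ¬ τ0 ≤ t)
      (g := fun t : ℕ => ((t : ℤ) - τ0).natAbs) (f := H)]
    · refine Finset.sum_le_sum_of_subset_of_nonneg ?_ fun u _ _ => hH u
      intro u hu
      obtain ⟨t, ht, rfl⟩ := Finset.mem_image.1 hu
      exact Finset.mem_range.2 (hlt t (Finset.mem_filter.1 ht).1)
    · intro a ha b hb hab
      have ha' := (Finset.mem_filter.1 ha).2
      have hb' := (Finset.mem_filter.1 hb).2
      simp only at hab
      omega

/-- Total energy of the adjoint differences of the bumps along one coordinate. -/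
theorem GridLine.sum_sq_bumpDiff_le (h : GridLine k N r L τ) {β : ℝ → ℝ} {C θ : ℝ}
    (hβ : ∀ y, 1 ≤ |y| → β y = 0)
    (hb : ∀ η, 0 < η → η ≤ 1 → ∀ y,
      |(fwdDiff η)^[k] β y| ≤ C * η ^ k * (1 + θ / √(|y| + η))) :
    ∑ t : Finset.Icc 1 N, (∑ m : Finset.Icc 1 r, |bumpDiff k N L τ β t m|) ^ 2 ≤
      8 * C ^ 2 * (k + 1) * (1 + θ ^ 2 * (1 + Real.log (L + k : ℕ))) *
        (r * (N : ℝ) ^ (2 * (k - 1)) * (L / (L : ℝ) ^ (2 * k))) := by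
  have hL : (0 : ℝ) < L := by exact_mod_cast h.radius_pos
  have hL1 : (1 : ℝ) ≤ L := by exact_mod_cast h.radius_pos
  rw [Finset.sum_coe_sort (Finset.Icc 1 N)
    (fun t : ℕ => (∑ m : Finset.Icc 1 r, |bumpDiff k N L τ β t m|) ^ 2)]
  have hcoe : ∀ t : ℕ, ∑ m : Finset.Icc 1 r, |bumpDiff k N L τ β t m| =
      ∑ m ∈ Finset.Icc 1 r, |bumpDiff k N L τ β t m| := fun t =>
    Finset.sum_coe_sort (Finset.Icc 1 r) (fun m : ℕ => |bumpDiff k N L τ β t m|)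
  simp only [hcoe]
  set H : ℕ → ℝ := fun u => 2 * C ^ 2 / (L : ℝ) ^ (2 * k) * (1 + θ ^ 2 * L * (1 / ((u : ℝ) + 1)))
    with hHdef
  have hH : ∀ u, 0 ≤ H u := fun u => by positivity
  have hcol : ∀ m ∈ Finset.Icc 1 r, ∑ t ∈ Finset.Icc 1 N, |bumpDiff k N L τ β t m| ^ 2 ≤
      (N : ℝ) ^ (2 * (k - 1)) * (2 * ∑ u ∈ Finset.range (L + k), H u) := by
    intro m hm
    obtain ⟨hm1, hmr⟩ := Finset.mem_Icc.1 hm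
    refine le_trans ?_ (mul_le_mul_of_nonneg_left
      (sum_natAbs_le (N := N) (τ0 := τ m) H hH) (by positivity))
    rw [Finset.mul_sum]
    rw [← Finset.sum_filter_of_ne (p := fun t : ℕ => ((t : ℤ) - τ m).natAbs < L + k)]
    · refine Finset.sum_le_sum fun t _ => ?_
      rw [h.abs_bumpDiff hβ hm1 hmr, mul_pow, ← pow_mul, mul_comm (k - 1) 2]
      refine mul_le_mul_of_nonneg_left ?_ (by positivity)
      have h1 := hb (1 / (L : ℝ)) (by positivity) (by rw [div_le_one hL]; exact hL1)
        (((t : ℝ) - τ m) / L)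
      refine (pow_le_pow_left₀ (abs_nonneg _) h1 2).trans ?_
      -- With `η = 1 / L`, squaring the singular factor produces harmonic terms in the distance to
      -- the knot; their sum gives the logarithm.
      have e1 : |((t : ℝ) - τ m) / L| + 1 / L = ((((t : ℤ) - τ m).natAbs : ℝ) + 1) / L := by
        rw [abs_div, abs_of_pos hL, ← add_div, Nat.cast_natAbs]
        push_cast
        rfl
      set U : ℝ := (((t : ℤ) - τ m).natAbs : ℝ) + 1 with hU
      have hUpos : 0 < U := by positivity
      rw [e1]
      have e2 : (θ / √(U / L)) ^ 2 = θ ^ 2 * L * (1 / U) := by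
        rw [div_pow, Real.sq_sqrt (by positivity)]
        field_simp
      have e3 : (C * (1 / (L : ℝ)) ^ k) ^ 2 = C ^ 2 / (L : ℝ) ^ (2 * k) := by
        rw [mul_pow, one_div, inv_pow, inv_pow, ← pow_mul, mul_comm k 2]; rfl
      rw [mul_pow, e3]
      have e4 : (1 + θ / √(U / L)) ^ 2 ≤ 2 * (1 + θ ^ 2 * L * (1 / U)) := by
        rw [← e2]; nlinarith [sq_nonneg (1 - θ / √(U / L))]
      calc _ ≤ C ^ 2 / (L : ℝ) ^ (2 * k) * (2 * (1 + θ ^ 2 * L * (1 / U))) :=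
            mul_le_mul_of_nonneg_left e4 (by positivity)
        _ = _ := by rw [hHdef]; ring
    · intro t _ hne
      have hne' : bumpDiff k N L τ β t m ≠ 0 := by
        intro h0; apply hne; rw [h0]; norm_num
      have := h.close_of_bumpDiff_ne_zero hβ hm1 hmr hne'
      omega
  have hsumH : ∑ u ∈ Finset.range (L + k), H u ≤
      2 * C ^ 2 * (k + 1) * (1 + θ ^ 2 * (1 + Real.log (L + k : ℕ))) *
        (L / (L : ℝ) ^ (2 * k)) := by
    have h1 : ∑ u ∈ Finset.range (L + k), H u = 2 * C ^ 2 / (L : ℝ) ^ (2 * k) *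
        ((L + k : ℕ) + θ ^ 2 * L * ∑ u ∈ Finset.range (L + k), 1 / ((u : ℝ) + 1)) := by
      simp only [hHdef, ← Finset.mul_sum, Finset.sum_add_distrib]
      simp
    have h2 := sum_range_inv_succ_le (L + k)
    have hlog : 0 ≤ 1 + Real.log (L + k : ℕ) := by
      have := Real.log_natCast_nonneg (L + k); linarith
    have h3 : ((L + k : ℕ) : ℝ) ≤ (k + 1) * L := by
      push_cast
      have : (0 : ℝ) ≤ k := by positivity
      nlinarith
    have h4 : θ ^ 2 * L * ∑ u ∈ Finset.range (L + k), 1 / ((u : ℝ) + 1) ≤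
        (k + 1) * (θ ^ 2 * L * (1 + Real.log (L + k : ℕ))) := by
      refine (mul_le_mul_of_nonneg_left h2 (by positivity)).trans ?_
      refine le_mul_of_one_le_left (by positivity) ?_
      have : (0 : ℝ) ≤ k := by positivity
      linarith
    rw [h1]
    calc _ ≤ 2 * C ^ 2 / (L : ℝ) ^ (2 * k) *
          ((k + 1) * L + (k + 1) * (θ ^ 2 * L * (1 + Real.log (L + k : ℕ)))) :=
          mul_le_mul_of_nonneg_left (add_le_add h3 h4) (by positivity)
      _ = _ := by ring
  calc ∑ t ∈ Finset.Icc 1 N, (∑ m ∈ Finset.Icc 1 r, |bumpDiff k N L τ β t m|) ^ 2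
      ≤ ∑ t ∈ Finset.Icc 1 N, 2 * ∑ m ∈ Finset.Icc 1 r, |bumpDiff k N L τ β t m| ^ 2 := by
        refine Finset.sum_le_sum fun t _ => ?_
        have e1 : ∑ m ∈ Finset.Icc 1 r, |bumpDiff k N L τ β t m| =
            ∑ m ∈ (Finset.Icc 1 r).filter (fun m => bumpDiff k N L τ β t m ≠ 0),
              |bumpDiff k N L τ β t m| := by
          rw [Finset.sum_filter_of_ne]
          intro m _ hne h0
          exact hne (by rw [h0, abs_zero])
        have e2 : ∑ m ∈ (Finset.Icc 1 r).filter (fun m => bumpDiff k N L τ β t m ≠ 0),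
              |bumpDiff k N L τ β t m| ^ 2 ≤ ∑ m ∈ Finset.Icc 1 r, |bumpDiff k N L τ β t m| ^ 2 :=
          Finset.sum_le_sum_of_subset_of_nonneg (Finset.filter_subset _ _)
            fun _ _ _ => by positivity
        rw [e1]
        -- At most two bumps are active at `t`, so the square of the sum costs only a factor 2.
        refine sq_sum_le_card_mul_sum_sq.trans ?_
        refine mul_le_mul ?_ e2 (Finset.sum_nonneg fun _ _ => by positivity) (by norm_num)
        exact_mod_cast h.overlap_le hβ t
    _ = 2 * ∑ m ∈ Finset.Icc 1 r, ∑ t ∈ Finset.Icc 1 N, |bumpDiff k N L τ β t m| ^ 2 := by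
        rw [← Finset.mul_sum, Finset.sum_comm]
    _ ≤ 2 * ∑ _m ∈ Finset.Icc 1 r,
          (N : ℝ) ^ (2 * (k - 1)) * (2 * ∑ u ∈ Finset.range (L + k), H u) :=
        mul_le_mul_of_nonneg_left (Finset.sum_le_sum hcol) (by norm_num)
    _ = 4 * (r * (N : ℝ) ^ (2 * (k - 1))) * ∑ u ∈ Finset.range (L + k), H u := by
        rw [Finset.sum_const, nsmul_eq_mul, Nat.card_Icc, Nat.add_sub_cancel]; ring
    _ ≤ 4 * (r * (N : ℝ) ^ (2 * (k - 1))) *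
          (2 * C ^ 2 * (k + 1) * (1 + θ ^ 2 * (1 + Real.log (L + k : ℕ))) *
            (L / (L : ℝ) ^ (2 * k))) :=
        mul_le_mul_of_nonneg_left hsumH (by positivity)
    _ = _ := by ring

end GridLine

/-! ### Interpolating sign patterns by superposed spikes -/

section Interpolation

variable {d k N r L : ℕ} {τ : Fin d → ℕ → ℕ}

/-- The value at `x` of the spike centred at the grid point with label `m`: the average over the
coordinates of products with the critical profile in one coordinate and cutoffs in the others. -/
noncomputable def spike (L : ℕ) (τ : Fin d → ℕ → ℕ) (α φ : ℝ → ℝ)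
    (m : Fin d → Finset.Icc 1 r) (x : Fin d → ℕ) : ℝ :=
  (d : ℝ)⁻¹ * ∑ i, ∏ l, (if l = i then α else φ) (((x l : ℝ) - τ l (m l)) / L)

theorem sum_spike_mul_diffKernel (α φ : ℝ → ℝ) (m : Fin d → Finset.Icc 1 r)
    (t : Fin d → Finset.Icc 1 N) :
    ∑ j : DiffIndex d k N, spike L τ α φ m (fun i => j i) * ∏ i, diffKernel k N (j i) (t i) =
      (d : ℝ)⁻¹ * ∑ i, ∏ l, bumpDiff k N L (τ l) (if l = i then α else φ) (t l) (m l) := by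
  simp only [spike, mul_assoc, ← Finset.mul_sum]
  congr 1
  simp only [Finset.sum_mul]
  rw [Finset.sum_comm]
  refine Finset.sum_congr rfl fun i _ => ?_
  simp only [bumpDiff]
  rw [Finset.prod_univ_sum, Fintype.piFinset_univ]
  refine Finset.sum_congr rfl fun j _ => ?_
  rw [← Finset.prod_mul_distrib]

/-- Energy of the adjoint difference of a signed superposition of spikes. -/
theorem sum_sq_superposition_le (hd : 1 ≤ d) {α φ : ℝ → ℝ} {c : (Fin d → Finset.Icc 1 r) → ℝ}
    (hc : ∀ m, |c m| ≤ 1) {A B : ℝ}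
    (hα : ∀ i, ∑ t : Finset.Icc 1 N, (∑ m : Finset.Icc 1 r, |bumpDiff k N L (τ i) α t m|) ^ 2 ≤ A)
    (hφ : ∀ i, ∑ t : Finset.Icc 1 N, (∑ m : Finset.Icc 1 r, |bumpDiff k N L (τ i) φ t m|) ^ 2 ≤ B) :
    ∑ t : Fin d → Finset.Icc 1 N, (∑ j : DiffIndex d k N,
      (∑ m, c m * spike L τ α φ m (fun i => j i)) * ∏ i, diffKernel k N (j i) (t i)) ^ 2 ≤
        A * B ^ (d - 1) := by
  have hd0 : (0 : ℝ) < d := by exact_mod_cast hd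
  set Z : Fin d → (Fin d → Finset.Icc 1 N) → ℝ := fun i t =>
    ∏ l, ∑ m : Finset.Icc 1 r, |bumpDiff k N L (τ l) (if l = i then α else φ) (t l) m| with hZ
  have hpt : ∀ t : Fin d → Finset.Icc 1 N, (∑ j : DiffIndex d k N,
      (∑ m, c m * spike L τ α φ m (fun i => j i)) * ∏ i, diffKernel k N (j i) (t i)) ^ 2 ≤
      (d : ℝ)⁻¹ * ∑ i, Z i t ^ 2 := by
    intro t
    have e1 : ∑ j : DiffIndex d k N,
        (∑ m, c m * spike L τ α φ m (fun i => j i)) * ∏ i, diffKernel k N (j i) (t i) =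
        ∑ m, c m * ((d : ℝ)⁻¹ *
          ∑ i, ∏ l, bumpDiff k N L (τ l) (if l = i then α else φ) (t l) (m l)) := by
      simp only [Finset.sum_mul, mul_assoc]
      rw [Finset.sum_comm]
      refine Finset.sum_congr rfl fun m _ => ?_
      rw [← Finset.mul_sum, sum_spike_mul_diffKernel]
    have e2 : |∑ m, c m * ((d : ℝ)⁻¹ *
          ∑ i, ∏ l, bumpDiff k N L (τ l) (if l = i then α else φ) (t l) (m l))| ≤
        (d : ℝ)⁻¹ * ∑ i, Z i t := by
      calc _ ≤ ∑ m : Fin d → Finset.Icc 1 r, (d : ℝ)⁻¹ *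
            ∑ i, ∏ l, |bumpDiff k N L (τ l) (if l = i then α else φ) (t l) (m l)| := by
            refine (Finset.abs_sum_le_sum_abs _ _).trans (Finset.sum_le_sum fun m _ => ?_)
            rw [abs_mul, abs_mul, abs_of_pos (inv_pos.2 hd0)]
            refine (mul_le_of_le_one_left (by positivity) (hc m)).trans ?_
            refine mul_le_mul_of_nonneg_left ?_ (by positivity)
            refine (Finset.abs_sum_le_sum_abs _ _).trans (Finset.sum_le_sum fun i _ => ?_)
            rw [Finset.abs_prod]
        _ = _ := by
            rw [← Finset.mul_sum, Finset.sum_comm]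
            congr 1
            refine Finset.sum_congr rfl fun i _ => ?_
            rw [hZ]
            simp only
            rw [Finset.prod_univ_sum, Fintype.piFinset_univ]
    rw [e1]
    refine (sq_le_sq' (abs_le.1 e2).1 (abs_le.1 e2).2).trans ?_
    have h3 := sq_sum_le_card_mul_sum_sq (s := Finset.univ) (f := fun i => Z i t)
    simp only [Finset.card_univ, Fintype.card_fin] at h3
    calc ((d : ℝ)⁻¹ * ∑ i, Z i t) ^ 2 = ((d : ℝ)⁻¹) ^ 2 * (∑ i, Z i t) ^ 2 := by ring
      _ ≤ ((d : ℝ)⁻¹) ^ 2 * (d * ∑ i, Z i t ^ 2) := by gcongr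
      _ = _ := by field_simp
  have hZsum : ∀ i, ∑ t, Z i t ^ 2 ≤ A * B ^ (d - 1) := by
    intro i
    have e1 : ∑ t, Z i t ^ 2 = ∏ l, ∑ t : Finset.Icc 1 N,
        (∑ m : Finset.Icc 1 r, |bumpDiff k N L (τ l) (if l = i then α else φ) t m|) ^ 2 := by
      rw [Finset.prod_univ_sum, Fintype.piFinset_univ]
      simp only [hZ, Finset.prod_pow]
    -- Coordinate `i` alone carries the critical profile and contributes `A`; the others contribute
    -- `B` each.
    rw [e1, ← Finset.mul_prod_erase Finset.univ _ (Finset.mem_univ i), if_pos rfl]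
    refine mul_le_mul (hα i) ?_ (Finset.prod_nonneg fun _ _ => Finset.sum_nonneg fun _ _ =>
      sq_nonneg _) ((Finset.sum_nonneg fun _ _ => sq_nonneg _).trans (hα i))
    calc _ ≤ ∏ _l ∈ Finset.univ.erase i, B := by
          refine Finset.prod_le_prod (fun _ _ => Finset.sum_nonneg fun _ _ => sq_nonneg _)
            fun l hl => ?_
          rw [if_neg (Finset.ne_of_mem_erase hl)]
          exact hφ l
      _ = _ := by simp
  calc _ ≤ ∑ t, (d : ℝ)⁻¹ * ∑ i, Z i t ^ 2 := Finset.sum_le_sum fun t _ => hpt t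
    _ = (d : ℝ)⁻¹ * ∑ i, ∑ t, Z i t ^ 2 := by rw [← Finset.mul_sum, Finset.sum_comm]
    _ ≤ (d : ℝ)⁻¹ * ∑ _i : Fin d, A * B ^ (d - 1) := by
        gcongr with i _
        exact hZsum i
    _ = _ := by simp; field_simp

variable {α φ : ℝ → ℝ}

theorem spike_nonneg (hα : ∀ y, 0 ≤ α y) (hφ : ∀ y, 0 ≤ φ y) (m : Fin d → Finset.Icc 1 r)
    (x : Fin d → ℕ) : 0 ≤ spike L τ α φ m x := by
  refine mul_nonneg (by positivity) (Finset.sum_nonneg fun i _ => Finset.prod_nonneg fun l _ => ?_)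
  split_ifs
  · exact hα _
  · exact hφ _

theorem spike_center (hd : 1 ≤ d) (hα : α 0 = 1) (hφ : φ 0 = 1) (m : Fin d → Finset.Icc 1 r) :
    spike L τ α φ m (fun i => τ i (m i)) = 1 := by
  have hd0 : (0 : ℝ) < d := by exact_mod_cast hd
  rw [spike]
  simp only [sub_self, zero_div]
  have : ∀ i l : Fin d, (if l = i then α else φ) 0 = 1 := by
    intro i l; split_ifs <;> assumption
  simp only [this]
  simp
  field_simp

theorem spike_eq_zero (hL : 1 ≤ L) (hα : ∀ y, 1 ≤ |y| → α y = 0) (hφ : ∀ y, 1 ≤ |y| → φ y = 0)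
    {m : Fin d → Finset.Icc 1 r} {x : Fin d → ℕ} {l : Fin d}
    (hl : (L : ℤ) ≤ |(x l : ℤ) - τ l (m l)|) : spike L τ α φ m x = 0 := by
  have hL0 : (0 : ℝ) < L := by exact_mod_cast hL
  have h1 : 1 ≤ |((x l : ℝ) - τ l (m l)) / L| := by
    rw [abs_div, abs_of_pos hL0, one_le_div hL0]
    exact_mod_cast hl
  rw [spike, Finset.sum_eq_zero, mul_zero]
  intro i _
  refine Finset.prod_eq_zero (Finset.mem_univ l) ?_
  split_ifs
  · exact hα _ h1
  · exact hφ _ h1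

/-- Cutoffs are at most 1 and can be dropped from each product. Averaging then gives additive decay
over the coordinates, the shape of `noiseWeight`. -/
theorem spike_le (hd : 1 ≤ d) {p : ℝ → ℝ} (hα0 : ∀ y, 0 ≤ α y) (hφ0 : ∀ y, 0 ≤ φ y)
    (hφ1 : ∀ y, φ y ≤ 1) (hα : ∀ y, |y| ≤ 1 → α y ≤ 1 - p |y|)
    {m : Fin d → Finset.Icc 1 r} {x : Fin d → ℕ}
    (hx : ∀ i, |((x i : ℝ) - τ i (m i)) / L| ≤ 1) :
    spike L τ α φ m x ≤ 1 - (d : ℝ)⁻¹ * ∑ i, p |((x i : ℝ) - τ i (m i)) / L| := by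
  have hd0 : (0 : ℝ) < d := by exact_mod_cast hd
  have h1 : ∑ i, ∏ l, (if l = i then α else φ) (((x l : ℝ) - τ l (m l)) / L) ≤
      ∑ i, (1 - p |((x i : ℝ) - τ i (m i)) / L|) := by
    refine Finset.sum_le_sum fun i _ => ?_
    rw [← Finset.mul_prod_erase Finset.univ _ (Finset.mem_univ i), if_pos rfl]
    refine (mul_le_of_le_one_right (hα0 _) ?_).trans (hα _ (hx i))
    refine Finset.prod_le_one (fun l hl => ?_) fun l hl => ?_
    · rw [if_neg (Finset.ne_of_mem_erase hl)]; exact hφ0 _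
    · rw [if_neg (Finset.ne_of_mem_erase hl)]; exact hφ1 _
  rw [spike]
  refine (mul_le_mul_of_nonneg_left h1 (by positivity)).trans (le_of_eq ?_)
  rw [Finset.sum_sub_distrib, mul_sub]
  simp
  field_simp

/-- Near a grid point only the spike centred there is active. -/
theorem superposition_of_close (hg : ∀ i, GridLine k N r L (τ i))
    (hα : ∀ y, 1 ≤ |y| → α y = 0) (hφ : ∀ y, 1 ≤ |y| → φ y = 0)
    (c : (Fin d → Finset.Icc 1 r) → ℝ) (hL : 1 ≤ L) {x : Fin d → ℕ} {m : Fin d → Finset.Icc 1 r}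
    (hm : ∀ i, |(x i : ℤ) - τ i (m i)| < L) :
    ∑ m', c m' * spike L τ α φ m' x = c m * spike L τ α φ m x := by
  refine Finset.sum_eq_single_of_mem m (Finset.mem_univ _) fun m' _ hne => ?_
  obtain ⟨l, hl⟩ := Function.ne_iff.1 hne
  rw [spike_eq_zero hL hα hφ (l := l), mul_zero]
  by_contra hcon
  refine hl (Subtype.ext ?_)
  have h1 := Finset.mem_Icc.1 (m' l).2
  have h2 := Finset.mem_Icc.1 (m l).2
  exact (hg l).eq_of_close_both (by omega) (by omega) (not_le.1 hcon) (hm l)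

/-- The noise weight at `j`, relative to a choice of grid points `near j`. -/
noncomputable def noiseWeight (r : ℕ) (ρ : ℝ) (τ : Fin d → ℕ → ℕ)
    (near : DiffIndex d k N → Fin d → ℕ) (j : DiffIndex d k N) : ℝ :=
  (d : ℝ)⁻¹ * ∑ i, √((|((j i : ℕ) : ℝ) - τ i (near j i)| * (r / (ρ * N))) ^ (2 * k - 1))

/-- Interpolation of signs on the grid subject to the noise weights. -/
theorem exists_interpolation (hd : 1 ≤ d) {ρ : ℝ} (hρ : 0 < ρ) (hN : 0 < N) (hr : 0 < r)
    (hg : ∀ i, GridLine k N r L (τ i)) (hL : 1 ≤ L) (hLr : (L : ℝ) * r ≤ ρ * N)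
    (hα1 : α 0 = 1) (hφ1 : φ 0 = 1) (hα0 : ∀ y, 0 ≤ α y) (hφ0 : ∀ y, 0 ≤ φ y)
    (hφle : ∀ y, φ y ≤ 1) (hαs : ∀ y, 1 ≤ |y| → α y = 0) (hφs : ∀ y, 1 ≤ |y| → φ y = 0)
    (hαle : ∀ y, |y| ≤ 1 → α y ≤ 1 - √(|y| ^ (2 * k - 1)))
    {near : DiffIndex d k N → Fin d → ℕ}
    (hnear : ∀ j i m, 1 ≤ m → m ≤ r →
      |((j i : ℕ) : ℝ) - τ i (near j i)| ≤ |((j i : ℕ) : ℝ) - τ i m|)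
    (hfar : ∀ j i, |((j i : ℕ) : ℝ) - τ i (near j i)| ≤ ρ * N / r)
    {S : Finset (DiffIndex d k N)}
    (hS : ∀ j, j ∈ S ↔ ∀ i, ∃ m, 1 ≤ m ∧ m ≤ r ∧ (j i : ℕ) = τ i m)
    {A B : ℝ}
    (hA : ∀ i, ∑ t : Finset.Icc 1 N, (∑ m : Finset.Icc 1 r, |bumpDiff k N L (τ i) α t m|) ^ 2 ≤ A)
    (hB : ∀ i, ∑ t : Finset.Icc 1 N, (∑ m : Finset.Icc 1 r, |bumpDiff k N L (τ i) φ t m|) ^ 2 ≤ B)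
    (q : DiffIndex d k N → ℝ) (hq : ∀ j, |q j| ≤ 1) :
    ∃ w : DiffIndex d k N → ℝ, (∀ j ∈ S, w j = q j) ∧
      (∀ j ∉ S, |w j| ≤ 1 - noiseWeight r ρ τ near j) ∧
      ∀ u : Tensor d N, ∑ j, w j * vitaliDiff k u j ≤ √(A * B ^ (d - 1)) * ‖u‖ := by
  have hd0 : (0 : ℝ) < d := by exact_mod_cast hd
  have hN0 : (0 : ℝ) < N := by exact_mod_cast hN
  have hr0 : (0 : ℝ) < r := by exact_mod_cast hr
  have hL0 : (0 : ℝ) < L := by exact_mod_cast hL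
  have hmem : ∀ (m : Fin d → Finset.Icc 1 r) i, τ i (m i) ∈ Finset.Icc (k + 1) N := by
    intro m i
    have h1 := Finset.mem_Icc.1 (m i).2
    have := (hg i).mem_of_close h1.1 h1.2 (z := τ i (m i)) (by simp; omega)
    exact Finset.mem_Icc.2 (by omega)
  set J : (Fin d → Finset.Icc 1 r) → DiffIndex d k N := fun m i => ⟨τ i (m i), hmem m i⟩
  refine ⟨fun j => ∑ m, q (J m) * spike L τ α φ m (fun i => j i), ?_, ?_, fun u => ?_⟩
  · intro j hj
    choose m hm1 hm2 hm3 using (hS j).1 hj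
    set M : Fin d → Finset.Icc 1 r := fun i => ⟨m i, Finset.mem_Icc.2 ⟨hm1 i, hm2 i⟩⟩
    have hjM : (fun i => (j i : ℕ)) = fun i => τ i (M i) := funext hm3
    have hJ : J M = j := funext fun i => Subtype.ext (hm3 i).symm
    simp only
    rw [superposition_of_close hg hαs hφs _ hL (m := M), hjM, spike_center hd hα1 hφ1, mul_one, hJ]
    intro i
    have : (j i : ℕ) = τ i (M i) := hm3 i
    simp only [this, sub_self, abs_zero]
    exact_mod_cast hL
  · intro j _
    simp only
    by_cases h : ∃ m : Fin d → Finset.Icc 1 r, ∀ i, |((j i : ℕ) : ℤ) - τ i (m i)| < L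
    · obtain ⟨m, hm⟩ := h
      rw [superposition_of_close hg hαs hφs _ hL hm, abs_mul,
        abs_of_nonneg (spike_nonneg hα0 hφ0 _ _)]
      refine (mul_le_of_le_one_left (spike_nonneg hα0 hφ0 _ _) (hq _)).trans ?_
      have hx : ∀ i, |(((j i : ℕ) : ℝ) - τ i (m i)) / L| ≤ 1 := by
        intro i
        rw [abs_div, abs_of_pos hL0, div_le_one hL0]
        have := (hm i).le
        exact_mod_cast this
      refine (spike_le hd (p := fun y => √(y ^ (2 * k - 1))) hα0 hφ0 hφle hαle hx).trans ?_
      refine sub_le_sub_left (mul_le_mul_of_nonneg_left (Finset.sum_le_sum fun i _ => ?_)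
        (by positivity)) 1
      -- The nearest knot is no farther than the active one, and `r / (ρ * N) ≤ 1 / L`.
      refine Real.sqrt_le_sqrt (pow_le_pow_left₀ (by positivity) ?_ _)
      rw [abs_div, abs_of_pos hL0, div_eq_mul_inv]
      have h1 := Finset.mem_Icc.1 (m i).2
      refine mul_le_mul (hnear j i _ h1.1 h1.2) ?_ (by positivity) (abs_nonneg _)
      rw [← div_eq_mul_inv, div_le_iff₀ (by positivity), inv_mul_eq_div, le_div_iff₀ hL0]
      linarith
    -- Away from all spikes `w` vanishes, and it suffices that the weight is at most 1, which the
    -- normalization by `ρ * N / r` ensures.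
    · push Not at h
      have h0 : ∑ m, q (J m) * spike L τ α φ m (fun i => j i) = 0 := by
        refine Finset.sum_eq_zero fun m _ => ?_
        obtain ⟨l, hl⟩ := h m
        rw [spike_eq_zero hL hαs hφs hl, mul_zero]
      rw [h0, abs_zero, sub_nonneg]
      have h1 : ∑ i, √((|((j i : ℕ) : ℝ) - τ i (near j i)| * (r / (ρ * N))) ^ (2 * k - 1)) ≤
          ∑ _i : Fin d, (1 : ℝ) := by
        refine Finset.sum_le_sum fun i _ => Real.sqrt_le_one.2 (pow_le_one₀ (by positivity) ?_)
        calc _ ≤ ρ * N / r * (r / (ρ * N)) :=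
              mul_le_mul_of_nonneg_right (hfar j i) (by positivity)
          _ = 1 := by field_simp
      rw [noiseWeight, inv_mul_le_iff₀ hd0]
      simpa using h1
  · refine (sum_mul_vitaliDiff_le _ u).trans (mul_le_mul_of_nonneg_right ?_ (norm_nonneg _))
    exact Real.sqrt_le_sqrt (sum_sq_superposition_le hd (fun m => hq (J m)) hA hB)

end Interpolation

/-! ### Regular grids, blocks of `k` indices, and atoms -/

section Grid

/-- Data of a regular grid in the form used by the interpolation: knots, a common radius, and the
nearest knots. -/
theorem IsRegularGrid.exists_gridLine {d k N : ℕ} (hd : 1 ≤ d) (hk : 1 ≤ k) {ρ : ℝ} (hρ : 1 ≤ ρ)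
    {S : Finset (DiffIndex d k N)} (hS : IsRegularGrid ρ S) :
    ∃ (r L : ℕ) (τ : Fin d → ℕ → ℕ), 1 ≤ r ∧ 2 * r ≤ N ∧ 1 ≤ L ∧ (∀ i, GridLine k N r L (τ i)) ∧
      (N : ℝ) / (4 * ρ * r) ≤ L ∧ (L : ℝ) * r ≤ N ∧
      (∀ i, ∀ m ≤ r, (τ i (m + 1) : ℝ) - τ i m ≤ ρ * N / r) ∧
      ∀ j : DiffIndex d k N, j ∈ S ↔ ∀ i, ∃ m, 1 ≤ m ∧ m ≤ r ∧ (j i : ℕ) = τ i m := by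
  obtain ⟨r, τ, hr, hends, hsp, hgap, hmem⟩ := hS
  have hρ0 : 0 < ρ := by linarith
  have hr0 : (0 : ℝ) < r := by exact_mod_cast hr
  set h : ℝ := N / (ρ * r) with hh
  have hh0 : 0 ≤ h := by positivity
  -- Half of the guaranteed spacing `h`. On very dense grids the radius 1 remains, where a bump is
  -- supported on its knot alone.
  set L := max 1 ⌊h / 2⌋₊ with hL
  have hfl : (⌊h / 2⌋₊ : ℝ) ≤ h / 2 := Nat.floor_le (by positivity)
  have hg : ∀ i, GridLine k N r L (τ i) := by
    intro i
    refine ⟨(hends i).1, (hends i).2, le_max_left _ _, fun m hm => ?_, hgap i⟩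
    obtain ⟨h1, h2, -⟩ := hsp i m hm
    have h3 : 2 * ⌊h / 2⌋₊ + τ i m ≤ τ i (m + 1) := by
      have : (2 * ⌊h / 2⌋₊ : ℝ) + τ i m ≤ τ i (m + 1) := by linarith
      exact_mod_cast this
    rcases le_total 1 ⌊h / 2⌋₊ with hc | hc
    · rw [hL, max_eq_right hc]; omega
    · rw [hL, max_eq_left hc]; omega
  have h2r : 2 * r ≤ N := (hg ⟨0, hd⟩).two_mul_le hk hr
  have h2r' : (2 : ℝ) * r ≤ N := by exact_mod_cast h2r
  refine ⟨r, L, τ, hr, h2r, le_max_left _ _, hg, ?_, ?_, fun i m hm => (hsp i m hm).2.2, hmem⟩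
  · have e : (N : ℝ) / (4 * ρ * r) = h / 4 := by rw [hh]; field_simp
    rw [e]
    -- If `h < 4` then `h / 4 ≤ 1 ≤ L`; otherwise rounding down loses at most `1 ≤ h / 4`.
    by_cases hc : h / 2 < 2
    · have : (1 : ℝ) ≤ L := by exact_mod_cast le_max_left 1 _
      linarith
    · have h1 : h / 2 < ⌊h / 2⌋₊ + 1 := Nat.lt_floor_add_one _
      have h2 : (⌊h / 2⌋₊ : ℝ) ≤ L := by exact_mod_cast le_max_right 1 _
      linarith
  · have hNr : h * r ≤ N := by
      rw [hh, div_mul_eq_mul_div, div_le_iff₀ (by positivity)]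
      have : (0 : ℝ) ≤ N := by positivity
      nlinarith [mul_nonneg this hr0.le, mul_le_mul_of_nonneg_right hρ (mul_nonneg this hr0.le)]
    rw [hL, Nat.cast_max, max_mul_of_nonneg _ _ hr0.le]
    refine max_le (by push_cast; linarith) ?_
    nlinarith

/-- Only interior knots compete. The end spacings still matter: they bound the distance for points
before the first or after the last interior knot. -/
theorem GridLine.exists_nearest {k N r L : ℕ} {τ : ℕ → ℕ} (h : GridLine k N r L τ) (hr : 1 ≤ r)
    {b : ℝ} (hb : ∀ m ≤ r, (τ (m + 1) : ℝ) - τ m ≤ b) {x : ℕ} (hx : x ∈ Finset.Icc (k + 1) N) :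
    ∃ m, (1 ≤ m ∧ m ≤ r) ∧ (∀ m', 1 ≤ m' → m' ≤ r → |(x : ℝ) - τ m| ≤ |(x : ℝ) - τ m'|) ∧
      |(x : ℝ) - τ m| ≤ b := by
  obtain ⟨hx1, hx2⟩ := Finset.mem_Icc.1 hx
  have hex : ∃ m, (1 ≤ m ∧ m ≤ r) ∧ |(x : ℝ) - τ m| ≤ b := by
    by_cases hc : x ≤ τ 1
    · refine ⟨1, ⟨le_rfl, hr⟩, ?_⟩
      have h1 := hb 0 (by omega)
      rw [h.left] at h1
      have h2 : (x : ℝ) ≤ τ 1 := by exact_mod_cast hc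
      have h3 : ((k + 1 : ℕ) : ℝ) ≤ x := by exact_mod_cast hx1
      rw [abs_of_nonpos (by linarith)]
      simp only [zero_add] at h1
      linarith
    · have hex' : ∃ m, x ≤ τ (m + 1) := ⟨r, by rw [h.right]; exact hx2⟩
      classical
      set m := Nat.find hex' with hm
      have h1 : x ≤ τ (m + 1) := Nat.find_spec hex'
      have hmr : m ≤ r := Nat.find_min' hex' (by rw [h.right]; exact hx2)
      have hm1 : 1 ≤ m := by
        rcases Nat.eq_zero_or_pos m with h0 | h0
        · rw [h0] at h1; exact absurd h1 hc
        · exact h0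
      have h2 : ¬ x ≤ τ (m - 1 + 1) := Nat.find_min hex' (by omega)
      rw [Nat.sub_add_cancel hm1] at h2
      refine ⟨m, ⟨hm1, hmr⟩, ?_⟩
      have h3 := hb m hmr
      have h4 : (x : ℝ) ≤ τ (m + 1) := by exact_mod_cast h1
      have h5 : (τ m : ℝ) ≤ x := by exact_mod_cast (not_le.1 h2).le
      rw [abs_of_nonneg (by linarith)]
      linarith
  obtain ⟨m, hm, hmin⟩ := (Finset.Icc 1 r).exists_min_image (fun m => |(x : ℝ) - τ m|)
    ⟨1, Finset.mem_Icc.2 ⟨le_rfl, hr⟩⟩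
  refine ⟨m, Finset.mem_Icc.1 hm, fun m' h1 h2 => hmin m' (Finset.mem_Icc.2 ⟨h1, h2⟩), ?_⟩
  obtain ⟨m0, hm0, hle⟩ := hex
  exact (hmin m0 (Finset.mem_Icc.2 hm0)).trans hle

variable {d k N r L : ℕ} {τ : Fin d → ℕ → ℕ}

theorem card_grid (hg : ∀ i, GridLine k N r L (τ i)) {S : Finset (DiffIndex d k N)}
    (hS : ∀ j, j ∈ S ↔ ∀ i, ∃ m, 1 ≤ m ∧ m ≤ r ∧ (j i : ℕ) = τ i m) : S.card = r ^ d := by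
  classical
  have h1 : S = Fintype.piFinset fun i => Finset.univ.filter
      fun x : Finset.Icc (k + 1) N => ∃ m, 1 ≤ m ∧ m ≤ r ∧ (x : ℕ) = τ i m := by
    ext j
    simp [hS]
  rw [h1, Fintype.card_piFinset]
  calc _ = ∏ _i : Fin d, r := by
        refine Finset.prod_congr rfl fun i _ => ?_
        have h2 : (Finset.univ.filter fun x : Finset.Icc (k + 1) N =>
            ∃ m, 1 ≤ m ∧ m ≤ r ∧ (x : ℕ) = τ i m).image Subtype.val =
            (Finset.Icc 1 r).image (τ i) := by
          ext y
          simp only [Finset.mem_image, Finset.mem_filter, Finset.mem_univ, true_and,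
            Finset.mem_Icc]
          constructor
          · rintro ⟨x, ⟨m, hm1, hm2, e⟩, rfl⟩
            exact ⟨m, ⟨hm1, hm2⟩, e.symm⟩
          · rintro ⟨m, ⟨hm1, hm2⟩, rfl⟩
            have := (hg i).mem_of_close hm1 hm2 (z := τ i m)
              (by have := (hg i).radius_pos; simp; omega)
            exact ⟨⟨τ i m, Finset.mem_Icc.2 (by omega)⟩, ⟨m, hm1, hm2, rfl⟩, rfl⟩
        rw [← Finset.card_image_of_injective _ Subtype.val_injective, h2,
          Finset.card_image_of_injOn, Nat.card_Icc, Nat.add_sub_cancel]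
        intro a ha b hb hab
        have ha' := Finset.mem_Icc.1 ha
        have hb' := Finset.mem_Icc.1 hb
        refine (hg i).eq_of_close (by omega) (by omega) ?_
        have := (hg i).radius_pos
        have hab' : τ i a = τ i b := hab
        rw [hab']; simp; omega
    _ = r ^ d := by simp

/-- The grid thickened to blocks of `k` consecutive indices. -/
def blockGrid (k N r : ℕ) (τ : Fin d → ℕ → ℕ) : Finset (DiffIndex d k N) :=
  Finset.univ.filter fun j => ∀ i, ∃ m ∈ Finset.Icc 1 r, (j i : ℕ) ∈ Finset.Ico (τ i m) (τ i m + k)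

theorem card_blockGrid_le : (blockGrid (d := d) k N r τ).card ≤ (k * r) ^ d := by
  classical
  have h1 : blockGrid k N r τ = Fintype.piFinset fun i => Finset.univ.filter
      fun x : Finset.Icc (k + 1) N =>
        ∃ m ∈ Finset.Icc 1 r, (x : ℕ) ∈ Finset.Ico (τ i m) (τ i m + k) := by
    ext j
    simp [blockGrid]
  rw [h1, Fintype.card_piFinset]
  calc _ ≤ ∏ _i : Fin d, k * r := by
        refine Finset.prod_le_prod' fun i _ => ?_
        rw [← Finset.card_image_of_injective _ Subtype.val_injective]
        calc _ ≤ ((Finset.Icc 1 r).biUnion fun m => Finset.Ico (τ i m) (τ i m + k)).card := by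
              refine Finset.card_le_card fun y hy => ?_
              obtain ⟨x, hx, rfl⟩ := Finset.mem_image.1 hy
              exact Finset.mem_biUnion.2 (Finset.mem_filter.1 hx).2
          _ ≤ ∑ m ∈ Finset.Icc 1 r, (Finset.Ico (τ i m) (τ i m + k)).card :=
              Finset.card_biUnion_le
          _ = k * r := by simp [mul_comm]
    _ = (k * r) ^ d := by simp

theorem subset_blockGrid (hk : 1 ≤ k) {S : Finset (DiffIndex d k N)}
    (hS : ∀ j, j ∈ S ↔ ∀ i, ∃ m, 1 ≤ m ∧ m ≤ r ∧ (j i : ℕ) = τ i m) :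
    S ⊆ blockGrid k N r τ := by
  intro j hj
  refine Finset.mem_filter.2 ⟨Finset.mem_univ _, fun i => ?_⟩
  obtain ⟨m, h1, h2, h3⟩ := (hS j).1 hj i
  exact ⟨m, Finset.mem_Icc.2 ⟨h1, h2⟩, Finset.mem_Ico.2 (by omega)⟩

/-- The dictionary atom of the index `j`. -/
noncomputable def atom (j : DiffIndex d k N) : Tensor d N :=
  prodTensor N fun i => truncPoly k N (j i) (j i)

theorem vitaliDiff_atom (hk : 1 ≤ k) (j : DiffIndex d k N) (hN : 1 ≤ N) :
    vitaliDiff k (atom j) = Pi.single j 1 := by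
  funext j'
  have h : ∀ x : Finset.Icc (k + 1) N, k + 1 ≤ (x : ℕ) := fun x => (Finset.mem_Icc.1 x.2).1
  rw [atom, vitaliDiff_prodTensor]
  simp only [diffOne_truncPoly_self hk hN (h _) (h _), Pi.single_apply]
  rw [Finset.prod_ite_zero]
  simp only [Finset.prod_const_one, Finset.mem_univ, true_implies]
  congr 1
  simp only [funext_iff, Subtype.ext_iff]

/-- The atom with its cuts moved to knots has difference supported on the block grid, so the
projection kills it and only the displacement remains. -/
theorem norm_proj_atom_le (hk : 1 ≤ k) (hN : 1 ≤ N) {near : DiffIndex d k N → Fin d → ℕ}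
    (hmem : ∀ j i, 1 ≤ near j i ∧ near j i ≤ r) (j : DiffIndex d k N) :
    ‖(coeffSupported (vitaliDiff k) (blockGrid k N r τ))ᗮ.starProjection (atom j)‖ ≤
      √((N : ℝ) ^ d) * (√d *
        ∑ i, √((|((j i : ℕ) : ℝ) - τ i (near j i)| / N) ^ (2 * k - 1))) := by
  set W := coeffSupported (vitaliDiff (d := d) k) (blockGrid k N r τ)
  set p : Tensor d N := prodTensor N fun i => truncPoly k N (j i) (τ i (near j i))
  have hp : p ∈ W := by
    intro j' hj'
    rw [vitaliDiff_prodTensor]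
    have : ¬ ∀ i, ∃ m ∈ Finset.Icc 1 r, (j' i : ℕ) ∈ Finset.Ico (τ i m) (τ i m + k) :=
      fun hcon => hj' (Finset.mem_filter.2 ⟨Finset.mem_univ _, hcon⟩)
    push Not at this
    obtain ⟨i, hi⟩ := this
    refine Finset.prod_eq_zero (Finset.mem_univ i) ?_
    have h1 := hi (near j i) (Finset.mem_Icc.2 (hmem j i))
    rw [Finset.mem_Ico] at h1
    exact diffOne_truncPoly_eq_zero hk (Finset.mem_Icc.1 (j' i).2).1 (by omega)
  have h0 : Wᗮ.starProjection p = 0 :=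
    (Submodule.starProjection_apply_eq_zero_iff _).2 (by rwa [Submodule.orthogonal_orthogonal])
  have h1 : Wᗮ.starProjection (atom j) = Wᗮ.starProjection (atom j - p) := by
    rw [map_sub, h0, sub_zero]
  rw [h1]
  exact (Submodule.norm_starProjection_apply_le _ _).trans
    (norm_atom_sub_le hk hN j fun i => τ i (near j i))

end Grid

/-! ### The oracle inequality on the noise event -/

section Bounds

/-- Bumps of width at least `N / (4 ρ r)` turn `L ^ (1 - 2 k)` into powers of `r`; a single `1 / N`
is left over per coordinate. -/
theorem energy_scale_le {k N r L : ℕ} {ρ : ℝ} (hk : 1 ≤ k) (hN : 1 ≤ N) (hr : 1 ≤ r) (hL : 1 ≤ L)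
    (hρ : 0 < ρ) (h : (N : ℝ) / (4 * ρ * r) ≤ L) :
    (r : ℝ) * (N : ℝ) ^ (2 * (k - 1)) * (L / (L : ℝ) ^ (2 * k)) ≤
      (4 * ρ) ^ (2 * k - 1) * (r : ℝ) ^ (2 * k) / N := by
  have hN0 : (0 : ℝ) < N := by exact_mod_cast hN
  have hr0 : (0 : ℝ) < r := by exact_mod_cast hr
  have hL0 : (0 : ℝ) < L := by exact_mod_cast hL
  obtain ⟨p, rfl⟩ : ∃ p, k = p + 1 := ⟨k - 1, by omega⟩
  have e1 : 2 * (p + 1) - 1 = 2 * p + 1 := by omega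
  have e2 : 2 * (p + 1) = 2 * p + 1 + 1 := by ring
  rw [e1, Nat.add_sub_cancel, e2]
  have h1 : (L : ℝ) / (L : ℝ) ^ (2 * p + 1 + 1) = ((L : ℝ)⁻¹) ^ (2 * p + 1) := by
    rw [pow_succ, inv_pow]; field_simp
  have h2 : (L : ℝ)⁻¹ ≤ 4 * ρ * r / N := by
    rw [inv_le_comm₀ hL0 (by positivity), inv_div]
    exact h
  rw [h1]
  calc (r : ℝ) * (N : ℝ) ^ (2 * p) * ((L : ℝ)⁻¹) ^ (2 * p + 1)
      ≤ (r : ℝ) * (N : ℝ) ^ (2 * p) * (4 * ρ * r / N) ^ (2 * p + 1) := by gcongr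
    _ = _ := by
      rw [div_pow, mul_pow _ (r : ℝ), pow_succ (N : ℝ), pow_succ (r : ℝ) (2 * p + 1)]
      field_simp

theorem log_ratio_eq {N r d : ℕ} :
    Real.log ((N : ℝ) ^ d / (r : ℝ) ^ d) = d * Real.log ((N : ℝ) / r) := by
  rw [← div_pow, Real.log_pow]

theorem log_two_le_log_ratio {N r d : ℕ} (hd : 1 ≤ d) (hr : 1 ≤ r) (h2 : 2 * r ≤ N) :
    Real.log 2 ≤ Real.log ((N : ℝ) ^ d / (r : ℝ) ^ d) := by
  have hr0 : (0 : ℝ) < r := by exact_mod_cast hr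
  have h2' : (2 : ℝ) * r ≤ N := by exact_mod_cast h2
  have hd' : (1 : ℝ) ≤ d := by exact_mod_cast hd
  have h3 : Real.log 2 ≤ Real.log ((N : ℝ) / r) :=
    Real.log_le_log (by norm_num) (by rwa [le_div_iff₀ hr0])
  have h4 : 0 < Real.log 2 := Real.log_pos (by norm_num)
  rw [log_ratio_eq]
  nlinarith

theorem two_add_log_le {k N r L d : ℕ} (hd : 1 ≤ d) (hr : 1 ≤ r) (h2 : 2 * r ≤ N) (hL : 1 ≤ L)
    (hLr : (L : ℝ) * r ≤ N) :
    2 + Real.log (L + k : ℕ) ≤ ((2 + Real.log (k + 1)) / Real.log 2 + 1) *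
      Real.log ((N : ℝ) ^ d / (r : ℝ) ^ d) := by
  have hr0 : (0 : ℝ) < r := by exact_mod_cast hr
  have hL0 : (1 : ℝ) ≤ L := by exact_mod_cast hL
  have h2' : (2 : ℝ) * r ≤ N := by exact_mod_cast h2
  have hd' : (1 : ℝ) ≤ d := by exact_mod_cast hd
  have hk0 : (0 : ℝ) ≤ k := by positivity
  have hN0 : (0 : ℝ) < N := by linarith
  have hlog2 : 0 < Real.log 2 := Real.log_pos (by norm_num)
  have hlogk : 0 ≤ Real.log ((k : ℝ) + 1) := Real.log_nonneg (by linarith)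
  have h4 := log_two_le_log_ratio hd hr h2
  have h5 : Real.log ((N : ℝ) / r) ≤ Real.log ((N : ℝ) ^ d / (r : ℝ) ^ d) := by
    rw [log_ratio_eq]
    have : 0 ≤ Real.log ((N : ℝ) / r) :=
      Real.log_nonneg (by rw [le_div_iff₀ hr0]; linarith)
    nlinarith
  have h6 : Real.log (L + k : ℕ) ≤ Real.log ((k : ℝ) + 1) + Real.log ((N : ℝ) / r) := by
    rw [← Real.log_mul (by positivity) (by positivity)]
    refine Real.log_le_log (by push_cast; linarith) ?_
    have h7 : (L : ℝ) ≤ N / r := by rwa [le_div_iff₀ hr0]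
    push_cast
    nlinarith
  set ℓ := Real.log ((N : ℝ) ^ d / (r : ℝ) ^ d)
  have h8 : 2 + Real.log ((k : ℝ) + 1) ≤ (2 + Real.log ((k : ℝ) + 1)) / Real.log 2 * ℓ := by
    rw [div_mul_eq_mul_div, le_div_iff₀ hlog2]
    exact mul_le_mul_of_nonneg_left h4 (by linarith)
  linarith

theorem mul_add_div_sq_le {n : ℝ} (hn : 0 < n) (lam a b : ℝ) :
    n * (lam * a + b / n) ^ 2 ≤ 2 * lam ^ 2 * (n * a ^ 2) + 2 * (b ^ 2 / n) := by
  have e : 2 * lam ^ 2 * (n * a ^ 2) + 2 * (b ^ 2 / n) - n * (lam * a + b / n) ^ 2 =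
      n * (lam * a - b / n) ^ 2 := by field_simp; ring
  have : 0 ≤ n * (lam * a - b / n) ^ 2 := by positivity
  linarith

open scoped RealInnerProductSpace in
set_option maxHeartbeats 1000000 in
/-- The oracle inequality on the event where the noise is controlled along the atoms and along an
orthonormal basis of the span of the active block. -/
theorem oracle_of_noise_event {d k N r L : ℕ} {τ : Fin d → ℕ → ℕ} {α φ : ℝ → ℝ} {C ρ : ℝ}
    (hd : 1 ≤ d) (hk : 1 ≤ k) (hρ : 1 ≤ ρ) (hr : 1 ≤ r) (h2r : 2 * r ≤ N) (hL : 1 ≤ L)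
    (hg : ∀ i, GridLine k N r L (τ i))
    (hNL : (N : ℝ) / (4 * ρ * r) ≤ L) (hLr : (L : ℝ) * r ≤ N)
    (hsp : ∀ i, ∀ m ≤ r, (τ i (m + 1) : ℝ) - τ i m ≤ ρ * N / r)
    {S : Finset (DiffIndex d k N)}
    (hS : ∀ j, j ∈ S ↔ ∀ i, ∃ m, 1 ≤ m ∧ m ≤ r ∧ (j i : ℕ) = τ i m)
    (hα1 : α 0 = 1) (hφ1 : φ 0 = 1) (hα0 : ∀ y, 0 ≤ α y) (hφ0 : ∀ y, 0 ≤ φ y)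
    (hφle : ∀ y, φ y ≤ 1) (hαs : ∀ y, 1 ≤ |y| → α y = 0) (hφs : ∀ y, 1 ≤ |y| → φ y = 0)
    (hαle : ∀ y, |y| ≤ 1 → α y ≤ 1 - √(|y| ^ (2 * k - 1)))
    (hφd : ∀ η, 0 < η → η ≤ 1 → ∀ y, |(fwdDiff η)^[k] φ y| ≤ C * η ^ k)
    (hαd : ∀ η, 0 < η → η ≤ 1 → ∀ y,
      |(fwdDiff η)^[k] α y| ≤ C * η ^ k * (1 + 1 / √(|y| + η)))
    {σ x lam : ℝ} (hσ : 0 < σ) (hx : 0 ≤ x)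
    (hlam : √((ρ / r) ^ (2 * k - 1)) * (d * √d) * (σ * x / √((N : ℝ) ^ d)) ≤ lam)
    {f0 eps f : Tensor d N}
    (hatom : ∀ j : DiffIndex d k N, |⟪eps, (coeffSupported (vitaliDiff k) (blockGrid k N r τ))ᗮ.starProjection
      (atom j)⟫| ≤
        σ * x * ‖(coeffSupported (vitaliDiff k) (blockGrid k N r τ))ᗮ.starProjection (atom j)‖)
    (hbasis : ∀ i, |⟪eps, (stdOrthonormalBasis ℝ
      (coeffSpan (vitaliDiff (d := d) k) (blockGrid k N r τ)) i : Tensor d N)⟫| ≤ σ * x)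
    (hf : IsTrendFilter k lam (f0 + eps) f) (g : Tensor d N) :
    ‖margin k (f - f0)‖ ^ 2 / (N : ℝ) ^ d ≤ ‖g - margin k f0‖ ^ 2 / (N : ℝ) ^ d
      + 4 * lam * ∑ j ∈ Sᶜ, |vitaliDiff k g j|
      + (2 * (8 * C ^ 2 * (k + 1) * (4 * ρ) ^ (2 * k - 1)) ^ d *
            ((2 + Real.log (k + 1)) / Real.log 2 + 1) + 2 * k ^ d / Real.log 2) *
          (lam ^ 2 * ((r : ℝ) ^ d) ^ (2 * k) * Real.log ((N : ℝ) ^ d / (r : ℝ) ^ d)) := by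
  have hρ0 : 0 < ρ := by linarith
  have hr0 : (0 : ℝ) < r := by exact_mod_cast hr
  have hr1 : (1 : ℝ) ≤ r := by exact_mod_cast hr
  have hN1 : 1 ≤ N := by omega
  have hN0 : (0 : ℝ) < N := by exact_mod_cast hN1
  have hd0 : (0 : ℝ) < d := by exact_mod_cast hd
  have hd1 : (1 : ℝ) ≤ d := by exact_mod_cast hd
  set n : ℝ := (N : ℝ) ^ d with hn
  have hn0 : 0 < n := by positivity
  set κ := √((ρ / r) ^ (2 * k - 1)) with hκ
  have hκ0 : 0 < κ := Real.sqrt_pos.2 (by positivity)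
  have hlam0 : 0 ≤ lam := le_trans (by positivity) hlam
  choose near hnear1 hnear2 hnear3 using fun (j : DiffIndex d k N) (i : Fin d) =>
    (hg i).exists_nearest hr (hsp i) (j i).2
  set T := blockGrid k N r τ with hT
  set c0 : ℝ := 8 * C ^ 2 * (k + 1) with hc0
  have hc0n : 0 ≤ c0 := by positivity
  set G : ℝ := (4 * ρ) ^ (2 * k - 1) * (r : ℝ) ^ (2 * k) / N with hG
  have hlogn : 0 ≤ Real.log (L + k : ℕ) := Real.log_natCast_nonneg _
  have hA : ∀ i, ∑ t : Finset.Icc 1 N,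
      (∑ m : Finset.Icc 1 r, |bumpDiff k N L (τ i) α t m|) ^ 2 ≤
        c0 * (2 + Real.log (L + k : ℕ)) * G := by
    intro i
    refine ((hg i).sum_sq_bumpDiff_le (θ := 1) hαs hαd).trans ?_
    have e : c0 * (1 + 1 ^ 2 * (1 + Real.log (L + k : ℕ))) = c0 * (2 + Real.log (L + k : ℕ)) := by
      ring
    rw [← hc0, e]
    exact mul_le_mul_of_nonneg_left (energy_scale_le hk hN1 hr hL hρ0 hNL) (by positivity)
  have hB : ∀ i, ∑ t : Finset.Icc 1 N,
      (∑ m : Finset.Icc 1 r, |bumpDiff k N L (τ i) φ t m|) ^ 2 ≤ c0 * G := by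
    intro i
    refine ((hg i).sum_sq_bumpDiff_le (θ := 0) hφs (C := C) (by simpa using hφd)).trans ?_
    have e : c0 * (1 + 0 ^ 2 * (1 + Real.log (L + k : ℕ))) = c0 := by ring
    rw [← hc0, e]
    exact mul_le_mul_of_nonneg_left (energy_scale_le hk hN1 hr hL hρ0 hNL) hc0n
  set Gam := √(c0 * (2 + Real.log (L + k : ℕ)) * G * (c0 * G) ^ (d - 1)) with hGam
  set A := √((k : ℝ) ^ d * (r : ℝ) ^ d) * (σ * x) with hAdef
  have hnoise : ∀ u : Tensor d N,
      ⟪eps, (LinearMap.ker (vitaliDiff (d := d) (N := N) k))ᗮ.starProjection u⟫ ≤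
      n * lam * ∑ j ∈ Sᶜ, noiseWeight r ρ τ near j * |vitaliDiff k u j| +
        A * ‖(LinearMap.ker (vitaliDiff (d := d) (N := N) k))ᗮ.starProjection u‖ := by
    intro u
    refine (noise_decomposition (vitaliDiff k) T atom (fun j => vitaliDiff_atom hk j hN1)
      eps u).trans (add_le_add ?_ (mul_le_mul_of_nonneg_right ?_ (norm_nonneg _)))
    · rw [Finset.mul_sum]
      have hw0 : ∀ j, 0 ≤ noiseWeight r ρ τ near j := fun j =>
        mul_nonneg (by positivity) (Finset.sum_nonneg fun _ _ => Real.sqrt_nonneg _)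
      -- The noise involves only indices off the blocks; since the weights are nonnegative, the sum
      -- may be enlarged to all indices off `S`.
      refine le_trans (Finset.sum_le_sum fun j _ => ?_)
        (Finset.sum_le_sum_of_subset_of_nonneg
          (Finset.compl_subset_compl.2 (subset_blockGrid hk hS)) fun j _ _ =>
            mul_nonneg (mul_nonneg hn0.le hlam0) (mul_nonneg (hw0 j) (abs_nonneg _)))
      rw [← mul_assoc]
      refine mul_le_mul_of_nonneg_right ?_ (abs_nonneg _)
      refine (hatom j).trans ?_
      have h1 := norm_proj_atom_le (τ := τ) hk hN1 hnear1 j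
      -- `κ` converts distances in units of `N` to units of `ρ * N / r`. Together with `d` from the
      -- average and `√d` from the atom bound it dictates the lower bound on `lam`.
      have h2 : ∑ i, √((|((j i : ℕ) : ℝ) - τ i (near j i)| / N) ^ (2 * k - 1)) =
          κ * (d * noiseWeight r ρ τ near j) := by
        rw [noiseWeight, mul_inv_cancel_left₀ hd0.ne', Finset.mul_sum]
        refine Finset.sum_congr rfl fun i _ => ?_
        rw [hκ, ← Real.sqrt_mul (by positivity), ← mul_pow]
        congr 2
        field_simp
      rw [h2] at h1
      have hsq : n / √n = √n := Real.div_sqrt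
      have hsn : 0 < √n := Real.sqrt_pos.2 hn0
      calc σ * x * _ ≤ σ * x * (√n * (√d * (κ * (d * noiseWeight r ρ τ near j)))) :=
            mul_le_mul_of_nonneg_left h1 (by positivity)
        _ = n * (κ * (d * √d) * (σ * x / √n)) * noiseWeight r ρ τ near j := by
            conv_lhs => rw [← hsq]
            ring
        _ ≤ n * lam * noiseWeight r ρ τ near j := by
            refine mul_le_mul_of_nonneg_right (mul_le_mul_of_nonneg_left hlam hn0.le) (hw0 j)
    · refine (norm_starProjection_le_of_basis _ (by positivity) hbasis).trans ?_
      refine mul_le_mul_of_nonneg_right (Real.sqrt_le_sqrt ?_) (by positivity)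
      rw [← mul_pow]
      exact_mod_cast (finrank_coeffSpan_le _ T).trans card_blockGrid_le
  have hρN : (L : ℝ) * r ≤ ρ * N := hLr.trans (by nlinarith)
  have horacle := analysis_oracle (vitaliDiff k) (Gam := Gam) (g := g) hn0 hlam0 hf hnoise
    (fun q hq => exists_interpolation hd hρ0 hN1 hr hg hL hρN hα1 hφ1 hα0 hφ0 hφle hαs hφs hαle
      hnear2 hnear3 hS hA hB q hq)
  refine horacle.trans ?_
  refine add_le_add le_rfl ?_
  set ℓ := Real.log (n / (r : ℝ) ^ d) with hℓ
  have hlog2 : 0 < Real.log 2 := Real.log_pos (by norm_num)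
  have hℓ2 : Real.log 2 ≤ ℓ := log_two_le_log_ratio hd hr h2r
  have hGam2 : n * Gam ^ 2 ≤ (c0 * (4 * ρ) ^ (2 * k - 1)) ^ d *
      (((2 + Real.log (k + 1)) / Real.log 2 + 1) * ℓ) * ((r : ℝ) ^ d) ^ (2 * k) := by
    rw [hGam, Real.sq_sqrt (by positivity)]
    -- The factors `1 / N` of the `d` energies cancel `n = N ^ d`.
    have e : n * (c0 * (2 + Real.log (L + k : ℕ)) * G * (c0 * G) ^ (d - 1)) =
        (c0 * (4 * ρ) ^ (2 * k - 1)) ^ d * (2 + Real.log (L + k : ℕ)) *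
          ((r : ℝ) ^ d) ^ (2 * k) := by
      have e1 : c0 * (2 + Real.log (L + k : ℕ)) * G * (c0 * G) ^ (d - 1) =
          (2 + Real.log (L + k : ℕ)) * (c0 * G) ^ d := by
        conv_rhs => rw [← Nat.sub_add_cancel hd, pow_succ]
        ring
      have e2 : n * (c0 * G) ^ d =
          (c0 * (4 * ρ) ^ (2 * k - 1)) ^ d * ((r : ℝ) ^ d) ^ (2 * k) := by
        rw [hn, ← mul_pow, ← pow_mul, mul_comm d (2 * k), pow_mul, ← mul_pow, hG]
        congr 1
        field_simp
      rw [e1, mul_left_comm, e2]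
      ring
    rw [e]
    have := two_add_log_le (k := k) hd hr h2r hL hLr
    gcongr
  have hA2 : A ^ 2 / n ≤ k ^ d * (lam ^ 2 * ((r : ℝ) ^ d) ^ (2 * k)) := by
    have h1 : A ^ 2 / n = k ^ d * (r : ℝ) ^ d * (σ * x / √n) ^ 2 := by
      rw [hAdef, mul_pow, Real.sq_sqrt (by positivity), div_pow, Real.sq_sqrt hn0.le]
      ring
    -- The product is `ρ ^ (2 k - 1)`, so the lower bound on `lam` makes the variance of the block
    -- part at most of order `lam ^ 2`.
    have hκr : 1 ≤ κ ^ 2 * (r : ℝ) ^ (2 * k - 1) := by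
      rw [hκ, Real.sq_sqrt (by positivity), ← mul_pow, div_mul_cancel₀ _ hr0.ne']
      exact one_le_pow₀ hρ
    have h2 : (σ * x / √n) ^ 2 ≤ lam ^ 2 * (r : ℝ) ^ (2 * k - 1) := by
      have hd2 : 1 ≤ (d : ℝ) * √d := by
        have : 1 ≤ √(d : ℝ) := Real.one_le_sqrt.2 hd1
        nlinarith
      have h3 : κ * (σ * x / √n) ≤ lam := by
        refine le_trans ?_ hlam
        rw [mul_assoc, mul_assoc]
        refine mul_le_mul_of_nonneg_left ?_ hκ0.le
        rw [← mul_assoc]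
        exact le_mul_of_one_le_left (by positivity) hd2
      have h4 : (κ * (σ * x / √n)) ^ 2 ≤ lam ^ 2 := pow_le_pow_left₀ (by positivity) h3 2
      calc (σ * x / √n) ^ 2 ≤ (κ ^ 2 * (r : ℝ) ^ (2 * k - 1)) * (σ * x / √n) ^ 2 :=
            le_mul_of_one_le_left (by positivity) hκr
        _ = (κ * (σ * x / √n)) ^ 2 * (r : ℝ) ^ (2 * k - 1) := by ring
        _ ≤ _ := by gcongr
    -- The gap between the exponents is `(d - 1) (2 k - 1) ≥ 0`.
    have h5 : (r : ℝ) ^ d * (r : ℝ) ^ (2 * k - 1) ≤ ((r : ℝ) ^ d) ^ (2 * k) := by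
      rw [← pow_add, ← pow_mul]
      refine pow_le_pow_right₀ hr1 ?_
      obtain ⟨p, rfl⟩ : ∃ p, k = p + 1 := ⟨k - 1, by omega⟩
      obtain ⟨e, rfl⟩ : ∃ e, d = e + 1 := ⟨d - 1, by omega⟩
      have : 2 * (p + 1) - 1 = 2 * p + 1 := by omega
      rw [this]
      nlinarith [Nat.zero_le (e * p)]
    rw [h1]
    calc (k : ℝ) ^ d * (r : ℝ) ^ d * (σ * x / √n) ^ 2
        ≤ (k : ℝ) ^ d * (r : ℝ) ^ d * (lam ^ 2 * (r : ℝ) ^ (2 * k - 1)) := by gcongr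
      _ = (k : ℝ) ^ d * (lam ^ 2 * ((r : ℝ) ^ d * (r : ℝ) ^ (2 * k - 1))) := by ring
      _ ≤ _ := by gcongr
  have hsplit := mul_add_div_sq_le hn0 lam Gam A
  have h6 : 2 * lam ^ 2 * (n * Gam ^ 2) ≤ 2 * lam ^ 2 * ((c0 * (4 * ρ) ^ (2 * k - 1)) ^ d *
      (((2 + Real.log (k + 1)) / Real.log 2 + 1) * ℓ) * ((r : ℝ) ^ d) ^ (2 * k)) :=
    mul_le_mul_of_nonneg_left hGam2 (by positivity)
  have h7 : (k : ℝ) ^ d * (lam ^ 2 * ((r : ℝ) ^ d) ^ (2 * k)) ≤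
      k ^ d / Real.log 2 * (lam ^ 2 * ((r : ℝ) ^ d) ^ (2 * k) * ℓ) := by
    rw [div_mul_eq_mul_div, le_div_iff₀ hlog2]
    calc _ = (k : ℝ) ^ d * (lam ^ 2 * ((r : ℝ) ^ d) ^ (2 * k) * Real.log 2) := by ring
      _ ≤ _ := by gcongr
  calc _ ≤ 2 * lam ^ 2 * (n * Gam ^ 2) + 2 * (A ^ 2 / n) := hsplit
    _ ≤ 2 * lam ^ 2 * ((c0 * (4 * ρ) ^ (2 * k - 1)) ^ d *
      (((2 + Real.log (k + 1)) / Real.log 2 + 1) * ℓ) * ((r : ℝ) ^ d) ^ (2 * k)) +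
      2 * (k ^ d / Real.log 2 * (lam ^ 2 * ((r : ℝ) ^ d) ^ (2 * k) * ℓ)) := by linarith
    _ = _ := by ring

end Bounds

/-! ### Probability of the noise event -/

section Main

theorem exp_neg_sq_half {n : ℝ} (hn : 1 ≤ n) :
    Real.exp (-√(4 * Real.log (2 * n)) ^ 2 / 2) = 1 / (4 * n ^ 2) := by
  have h1 : 0 ≤ Real.log (2 * n) := Real.log_nonneg (by linarith)
  rw [Real.sq_sqrt (by positivity), show -(4 * Real.log (2 * n)) / 2 =
    -(Real.log (2 * n) + Real.log (2 * n)) by ring, Real.exp_neg, Real.exp_add,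
    Real.exp_log (by positivity)]
  rw [one_div]; congr 1; ring

theorem lambda0_log_eq (σ : ℝ) {n : ℝ} (hn : 1 ≤ n) :
    lambda0 σ n (Real.log (2 * n)) = σ * √(4 * Real.log (2 * n)) / √n := by
  have h1 : 0 ≤ Real.log (2 * n) := Real.log_nonneg (by linarith)
  rw [lambda0, mul_div_assoc, ← Real.sqrt_div (by positivity)]
  congr 3
  ring

open scoped RealInnerProductSpace in
/-- The noise event has probability at least `1 - 1 / n`. -/
theorem noise_event_prob {d k N r : ℕ} (τ : Fin d → ℕ → ℕ) (hN : 1 ≤ N) {σ : NNReal} (hσ : 0 < σ)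
    {Ω : Type*} [MeasurableSpace Ω] {P : Measure Ω} [IsProbabilityMeasure P]
    {eps : Ω → Tensor d N}
    (hlaw : ∀ j, HasLaw (fun ω => eps ω j) (gaussianReal 0 (σ ^ 2)) P)
    (hind : iIndepFun (fun j ω => eps ω j) P) :
    ENNReal.ofReal (1 - 1 / (N : ℝ) ^ d) ≤ P {ω |
      (∀ j : DiffIndex d k N,
        |⟪eps ω, (coeffSupported (vitaliDiff k) (blockGrid k N r τ))ᗮ.starProjection (atom j)⟫| ≤
          σ * √(4 * Real.log (2 * (N : ℝ) ^ d)) *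
          ‖(coeffSupported (vitaliDiff k) (blockGrid k N r τ))ᗮ.starProjection (atom j)‖) ∧
      ∀ i, |⟪eps ω, (stdOrthonormalBasis ℝ
        (coeffSpan (vitaliDiff (d := d) k) (blockGrid k N r τ)) i : Tensor d N)⟫| ≤
          σ * √(4 * Real.log (2 * (N : ℝ) ^ d))} := by
  set V := coeffSpan (vitaliDiff (d := d) k) (blockGrid k N r τ)
  have hn1 : (1 : ℝ) ≤ (N : ℝ) ^ d := one_le_pow₀ (by exact_mod_cast hN)
  have hunion := gaussian_inner_union (P := P) hσ hlaw hind
    (β := DiffIndex d k N ⊕ Fin (Module.finrank ℝ V))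
    (Sum.elim (fun j => (coeffSupported (vitaliDiff k) (blockGrid k N r τ))ᗮ.starProjection
      (atom j)) fun i => (stdOrthonormalBasis ℝ V i : Tensor d N))
    (Real.sqrt_nonneg (4 * Real.log (2 * (N : ℝ) ^ d)))
  refine le_trans (ENNReal.ofReal_le_ofReal ?_) (hunion.trans (measure_mono fun ω hω => ?_))
  · rw [exp_neg_sq_half hn1]
    -- At most `2 n` functionals, each failing with probability at most `2 / (4 n ^ 2)`, fail in
    -- total with probability at most `1 / n`.
    have hcard : (Fintype.card (DiffIndex d k N ⊕ Fin (Module.finrank ℝ V)) : ℝ) ≤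
        2 * (N : ℝ) ^ d := by
      have h1 : Fintype.card (DiffIndex d k N) ≤ N ^ d := by
        rw [Fintype.card_fun]
        simp only [Fintype.card_coe, Nat.card_Icc, Fintype.card_fin]
        exact Nat.pow_le_pow_left (by omega) d
      have h2 : Module.finrank ℝ V ≤ N ^ d := by
        refine (Submodule.finrank_le V).trans (le_of_eq ?_)
        rw [finrank_euclideanSpace, Fintype.card_fun]
        simp
      rw [Fintype.card_sum, Fintype.card_fin]
      have h3 : Fintype.card (DiffIndex d k N) + Module.finrank ℝ V ≤ 2 * N ^ d := by omega
      exact_mod_cast h3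
    have e : 2 * (2 * (N : ℝ) ^ d) * (1 / (4 * ((N : ℝ) ^ d) ^ 2)) = 1 / (N : ℝ) ^ d := by
      field_simp; norm_num
    have : 2 * (Fintype.card (DiffIndex d k N ⊕ Fin (Module.finrank ℝ V)) : ℝ) *
        (1 / (4 * ((N : ℝ) ^ d) ^ 2)) ≤ 1 / (N : ℝ) ^ d := by
      rw [← e]; gcongr
    linarith
  · refine ⟨fun j => hω (Sum.inl j), fun i => ?_⟩
    have h1 := hω (Sum.inr i)
    have h2 : ‖(stdOrthonormalBasis ℝ V i : Tensor d N)‖ = 1 :=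
      (stdOrthonormalBasis ℝ V).orthonormal.1 i
    simpa [h2] using h1

theorem sqrt_pow_eq_rpow {y : ℝ} (hy : 0 ≤ y) {k : ℕ} (hk : 1 ≤ k) :
    √(y ^ (2 * k - 1)) = y ^ ((2 * (k : ℝ) - 1) / 2) := by
  rw [Real.sqrt_eq_rpow, ← Real.rpow_natCast, ← Real.rpow_mul hy]
  congr 1
  rw [Nat.cast_sub (by omega)]
  push_cast
  ring

end Main

end VitaliTF

/-! ### Assembly: constants, the oracle inequality and the rate -/

theorem theorem2p1 (k : ℕ) (hk : k ∈ ({1, 2, 3, 4} : Finset ℕ)) :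
    ∃ C : ℝ, 0 < C ∧ ∀ (ρ : ℝ) (_ : 1 ≤ ρ) (d : ℕ) (_ : 1 ≤ d), ∃ K : ℝ, 0 < K ∧
      ∀ (N : ℕ) (S : Finset (VitaliTF.DiffIndex d k N)) (_ : VitaliTF.IsRegularGrid ρ S)
        (n s : ℝ) (_ : n = (N : ℝ) ^ d) (_ : s = (S.card : ℝ))
        (σ : NNReal) (_ : 0 < σ)
        (Ω : Type*) [MeasurableSpace Ω] (P : Measure Ω) [IsProbabilityMeasure P]
        (ε : Ω → VitaliTF.Tensor d N)
        (_ : ∀ j, HasLaw (fun ω => ε ω j) (gaussianReal 0 (σ ^ 2)) P)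
        (_ : iIndepFun (fun j ω => ε ω j) P)
        (f0 g : VitaliTF.Tensor d N) (lam : ℝ)
        (_ : C * ρ ^ ((2 * (k : ℝ) - 1) / 2) * (d : ℝ) ^ ((3 : ℝ) / 2) *
            (VitaliTF.lambda0 σ n (Real.log (2 * n)) / s ^ ((2 * (k : ℝ) - 1) / (2 * d))) ≤ lam),
        (ENNReal.ofReal (1 - 1 / n) ≤
          P {ω | (∃ f, VitaliTF.IsTrendFilter k lam (f0 + ε ω) f) ∧
            ∀ f, VitaliTF.IsTrendFilter k lam (f0 + ε ω) f →
              ‖VitaliTF.margin k (f - f0)‖ ^ 2 / n ≤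
                ‖g - VitaliTF.margin k f0‖ ^ 2 / n
                  + 4 * lam * ∑ j ∈ Sᶜ, |VitaliTF.vitaliDiff k g j|
                  + K * (lam ^ 2 * s ^ (2 * k) * Real.log (n / s))}) ∧
        ∀ B : ℝ,
          lam ≤ B * (VitaliTF.lambda0 σ n (Real.log (2 * n)) /
            s ^ ((2 * (k : ℝ) - 1) / (2 * d))) →
          (∀ j ∉ S, VitaliTF.vitaliDiff k f0 j = 0) →
          ENNReal.ofReal (1 - 1 / n) ≤
            P {ω | (∃ f, VitaliTF.IsTrendFilter k lam (f0 + ε ω) f) ∧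
              ∀ f, VitaliTF.IsTrendFilter k lam (f0 + ε ω) f →
                ‖VitaliTF.margin k (f - f0)‖ ^ 2 / n ≤
                  K * (B ^ 2 * (σ : ℝ) ^ 2 *
                    (s ^ (2 * (k : ℝ) - (2 * (k : ℝ) - 1) / d) * Real.log n * Real.log (n / s)
                      / n))} := by
  have hk1 : 1 ≤ k := by
    simp only [Finset.mem_insert, Finset.mem_singleton] at hk
    omega
  obtain ⟨α, φ, C, hC, hα1, hφ1, hα0, hφ0, hφle, hαs, hφs, hαle, hφd, hαd⟩ :=
    VitaliTF.exists_profile hk1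
  refine ⟨1, one_pos, fun ρ hρ d hd => ?_⟩
  have hlog2 : 0 < Real.log 2 := Real.log_pos (by norm_num)
  have hρ0 : 0 < ρ := by linarith
  have hd0 : (0 : ℝ) < d := by exact_mod_cast hd
  set K : ℝ := 2 * (8 * C ^ 2 * (k + 1) * (4 * ρ) ^ (2 * k - 1)) ^ d *
    ((2 + Real.log (k + 1)) / Real.log 2 + 1) + 2 * k ^ d / Real.log 2 with hK
  have hK0 : 0 < K := by
    have h1 : 0 ≤ Real.log ((k : ℝ) + 1) := Real.log_nonneg (by linarith [k.cast_nonneg (α := ℝ)])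
    have h2 : (0 : ℝ) < k := by exact_mod_cast hk1
    positivity
  -- The oracle inequality needs only `K`; the factor 8 is for the rate, where `4 log (2 n) ≤ 8 log
  -- n` because `n ≥ 2`.
  refine ⟨8 * K, by positivity, ?_⟩
  intro N S hS n s hn hs σ hσ Ω _ P _ ε hlaw hind f0 g lam hlam
  obtain ⟨r, L, τ, hr, h2r, hL, hg, hNL, hLr, hsp, hSmem⟩ := hS.exists_gridLine hd hk1 hρ
  have hr0 : (0 : ℝ) < r := by exact_mod_cast hr
  have hN2 : 2 ≤ N := by omega
  have hn2 : 2 ≤ n := by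
    rw [hn]
    calc (2 : ℝ) ≤ N := by exact_mod_cast hN2
      _ ≤ (N : ℝ) ^ d := le_self_pow₀ (by exact_mod_cast (by omega : 1 ≤ N)) (by omega)
  have hs' : s = (r : ℝ) ^ d := by rw [hs, VitaliTF.card_grid hg hSmem]; push_cast; rfl
  have hs0 : 0 < s := by rw [hs']; positivity
  have hσ' : (0 : ℝ) < σ := hσ
  have hlogn : 0 < Real.log n := Real.log_pos (by linarith)
  set X : ℝ := VitaliTF.lambda0 σ n (Real.log (2 * n)) with hX
  set Q : ℝ := s ^ ((2 * (k : ℝ) - 1) / (2 * d)) with hQ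
  set x := √(4 * Real.log (2 * n)) with hx
  have hXx : X = σ * x / √n := VitaliTF.lambda0_log_eq σ (by linarith)
  have hx0 : 0 ≤ x := Real.sqrt_nonneg _
  have hQ0 : 0 < Q := Real.rpow_pos_of_pos hs0 _
  have hX0 : 0 ≤ X := by rw [hXx]; positivity
  have hlam' : √((ρ / r) ^ (2 * k - 1)) * (d * √d) * (σ * x / √((N : ℝ) ^ d)) ≤ lam := by
    have hsr : Q = (r : ℝ) ^ ((2 * (k : ℝ) - 1) / 2) := by
      rw [hQ, hs', ← Real.rpow_natCast, ← Real.rpow_mul hr0.le]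
      congr 1
      field_simp
    have hd32 : (d : ℝ) ^ ((3 : ℝ) / 2) = d * √d := by
      rw [show (3 : ℝ) / 2 = 1 + 1 / 2 by norm_num, Real.rpow_add hd0, Real.rpow_one,
        Real.sqrt_eq_rpow]
    rw [VitaliTF.sqrt_pow_eq_rpow (by positivity) hk1, Real.div_rpow hρ0.le hr0.le, ← hn, ← hsr,
      ← hXx]
    refine le_trans (le_of_eq ?_) hlam
    rw [hd32]
    ring
  have hlam0 : 0 ≤ lam := le_trans (by positivity) hlam'
  have hℓ : 0 < Real.log (n / s) := by
    rw [hn, hs']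
    exact hlog2.trans_le (VitaliTF.log_two_le_log_ratio hd hr h2r)
  have hprob := VitaliTF.noise_event_prob (k := k) (r := r) τ (by omega) hσ hlaw hind
  rw [← hn] at hprob
  have hex : ∀ ω, ∃ f, VitaliTF.IsTrendFilter k lam (f0 + ε ω) f := fun ω =>
    VitaliTF.exists_isMinOn_analysisObjective (VitaliTF.vitaliDiff k)
      (show (0 : ℝ) < (N : ℝ) ^ d by rw [← hn]; linarith) hlam0 _
  refine ⟨hprob.trans (measure_mono fun ω hω => ⟨hex ω, fun f hf => ?_⟩), fun B hB hf0 =>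
    hprob.trans (measure_mono fun ω hω => ⟨hex ω, fun f hf => ?_⟩)⟩
  · have key := VitaliTF.oracle_of_noise_event hd hk1 hρ hr h2r hL hg hNL hLr hsp hSmem hα1 hφ1 hα0
      hφ0 hφle hαs hφs hαle hφd hαd hσ' hx0 hlam' hω.1 hω.2 hf g
    rw [← hK, ← hn, ← hs'] at key
    refine key.trans (add_le_add le_rfl (mul_le_mul_of_nonneg_right ?_ (by positivity)))
    linarith
  -- With the margin of `f0` as oracle the approximation error is zero, and so is the penalty off
  -- `S`, since projecting does not change the differences.
  · have key := VitaliTF.oracle_of_noise_event hd hk1 hρ hr h2r hL hg hNL hLr hsp hSmem hα1 hφ1 hα0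
      hφ0 hφle hαs hφs hαle hφd hαd hσ' hx0 hlam' hω.1 hω.2 hf (VitaliTF.margin k f0)
    have hzero : ∑ j ∈ Sᶜ, |VitaliTF.vitaliDiff k (VitaliTF.margin k f0) j| = 0 := by
      refine Finset.sum_eq_zero fun j hj => ?_
      rw [VitaliTF.margin, VitaliTF.map_kerPerp, hf0 j (Finset.mem_compl.1 hj), abs_zero]
    rw [← hK, ← hn, ← hs', sub_self, norm_zero, hzero, mul_zero, add_zero,
      zero_pow two_ne_zero, zero_div, zero_add] at key
    refine key.trans ?_
    have hlam2 : lam ^ 2 ≤ (B * (X / Q)) ^ 2 := pow_le_pow_left₀ hlam0 hB 2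
    have hX2 : X ^ 2 ≤ 8 * ((σ : ℝ) ^ 2 * Real.log n / n) := by
      have hlog2n : Real.log (2 * n) ≤ 2 * Real.log n := by
        rw [Real.log_mul (by norm_num) (by linarith)]
        linarith [Real.log_le_log (by norm_num) hn2]
      have hpos : 0 ≤ Real.log (2 * n) := Real.log_nonneg (by linarith)
      rw [hXx, div_pow, mul_pow, hx, Real.sq_sqrt (by positivity), Real.sq_sqrt (by linarith),
        ← mul_div_assoc]
      refine div_le_div_of_nonneg_right ?_ (by linarith)
      nlinarith [sq_nonneg (σ : ℝ)]
    have hpow : s ^ (2 * (k : ℝ) - (2 * (k : ℝ) - 1) / d) = s ^ (2 * k) / Q ^ 2 := by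
      rw [Real.rpow_sub hs0, hQ, ← Real.rpow_natCast, ← Real.rpow_natCast (s ^ _) 2,
        ← Real.rpow_mul hs0.le]
      congr 2
      · push_cast; ring
      · push_cast; field_simp
    rw [hpow]
    calc K * (lam ^ 2 * s ^ (2 * k) * Real.log (n / s))
        ≤ K * ((B * (X / Q)) ^ 2 * s ^ (2 * k) * Real.log (n / s)) := by gcongr
      _ = K * (B ^ 2 * X ^ 2 * (s ^ (2 * k) / Q ^ 2) * Real.log (n / s)) := by ring
      _ ≤ K * (B ^ 2 * (8 * ((σ : ℝ) ^ 2 * Real.log n / n)) * (s ^ (2 * k) / Q ^ 2) *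
            Real.log (n / s)) := by gcongr
      _ = _ := by ring
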